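/- Let $n\ge 2$ and let $P\subseteq\mathbb{R}^n$ be an $n$-dimensional convex polytope with $P=-P$. Write $|\cdot|_k$ for $k$-dimensional volume, $\langle\cdot,\cdot\rangle$ and $\|\cdot\|$ for the Euclidean inner product and norm, $\mathrm{ext}(P)$ for the set of vertices of $P$, and $K^\circ=\{y:\langle x,y\rangle\le 1\text{ for all }x\in K\}$ for the polar of $K$. For a convex body $K$ in $\mathbb{R}^n$ and $\delta\ge 0$ let $$K_\delta=\bigcap_{|K\cap H^-|_n\le\delta|K|_n}H^+,\qquad K^\delta=\{x\in\mathbb{R}^n:|\mathrm{conv}[K\cup\{x\}]|_n\le(1+\delta)|K|_n\}$$ be the convex floating body and the illumination body of $K$, where $H$ runs over all hyperplanes and $H^+,H^-$ are the two closed half-spaces bounded by $H$, in either order. Put $$\mathtt d(S_1,S_2)=\inf\{a\ge1:\tfrac1a S_1\subseteq S_2\subseteq aS_1\},\qquad \mathtt d_P(\delta)=\inf_{\delta'>0}\mathtt d\bigl(P_\delta,((P^\circ)^{\delta'})^\circ\bigr).$$ For $\xi\in\mathrm{ext}(P)$ let $F_\xi$ be the facet of $P^\circ$ with outer normal $\xi$,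 let $s(F_\xi)$ be its $(n-1)$-dimensional Santaló point, that is, the point $s$ of the relative interior of $F_\xi$ for which $|(F_\xi-s)^\circ|_{n-1}$ is minimal, where the polar $(F_\xi-s)^\circ$ is taken within the $(n-1)$-dimensional linear subspace containing $F_\xi-s$. Put $$n_{P^\circ}(\xi)=\frac{1}{n|P^\circ|_n}\,\frac{1}{\|\xi\|}\,|F_\xi|_{n-1},\qquad n_P(\xi)=\frac{1}{n|P|_n}\,\|\xi\|\,\bigl|(F_\xi-s(F_\xi))^\circ\bigr|_{n-1}.$$ Then $$\lim_{\delta\to0^+}\frac{\mathtt d_P(\delta)-1}{\delta^{1/n}}=G(P):=\min_{c\ge0}\ \max_{\xi\in\mathrm{ext}(P)}\max\left\{\frac{n_{P^\circ}(\xi)-c\,n_P(\xi)^{1/n}}{n_P(\xi)^{1/n}\,n_{P^\circ}(\xi)},\ \frac{c}{\min_{\eta\in\mathrm{ext}(P)}n_{P^\circ}(\eta)}\right\};$$ in particular the limit exists, and the minimum over $c\ge0$ is attained. Moreover $G(LP)=G(P)$ for every invertible linear map $L:\mathbb{R}^n\to\mathbb{R}^n$. -/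

import Mathlib

open Set Filter Topology MeasureTheory
open scoped Pointwise RealInnerProductSpace

noncomputable section

namespace FloatIllum

variable {n : ℕ}

/-- Euclidean space of dimension `n`, with the Euclidean norm and Lebesgue measure. -/
abbrev E (n : ℕ) : Type := EuclideanSpace ℝ (Fin n)

/-- `P` is an `n`-dimensional convex polytope that is symmetric about the origin. -/
structure IsSymmPolytope (P : Set (E n)) : Prop where
  exists_finite : ∃ V : Set (E n), V.Finite ∧ P = convexHull ℝ V
  interior_nonempty : (interior P).Nonempty
  symm : ∀ x ∈ P, -x ∈ P

/-- The polar `K° = {y : ⟪x, y⟫ ≤ 1 for all x ∈ K}`. -/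
def polar (K : Set (E n)) : Set (E n) :=
  {y | ∀ x ∈ K, ⟪x, y⟫ ≤ 1}

/-- The convex floating body `K_δ`: the intersection of all closed half-spaces
`H⁺ = {x : ⟪u, x⟫ ≤ t}` whose complementary closed half-space `H⁻ = {x : t ≤ ⟪u, x⟫}`
satisfies `|K ∩ H⁻| ≤ δ |K|`. -/
def floatingBody (K : Set (E n)) (δ : ℝ) : Set (E n) :=
  {x | ∀ (u : E n) (t : ℝ), u ≠ 0 →
    volume (K ∩ {y | t ≤ ⟪u, y⟫}) ≤ ENNReal.ofReal δ * volume K → ⟪u, x⟫ ≤ t}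

/-- The illumination body `K^δ = {x : |conv[K, x]| ≤ (1 + δ) |K|}`. -/
def illuminationBody (K : Set (E n)) (δ : ℝ) : Set (E n) :=
  {x | volume (convexHull ℝ (K ∪ {x})) ≤ ENNReal.ofReal (1 + δ) * volume K}

/-- The polar `((K°)^δ)°` of the illumination body of the polar of `K`. -/
def polarIllumination (K : Set (E n)) (δ : ℝ) : Set (E n) :=
  polar (illuminationBody (polar K) δ)

/-- The distance `d(S₁, S₂) = inf {a ≥ 1 : (1 / a) S₁ ⊆ S₂ ⊆ a S₁}`. -/
def bodyDist (S₁ S₂ : Set (E n)) : ℝ :=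
  sInf {a : ℝ | 1 ≤ a ∧ (1 / a) • S₁ ⊆ S₂ ∧ S₂ ⊆ a • S₁}

/-- `d_K(δ) = inf_{δ' > 0} d(K_δ, ((K°)^δ')°)`. -/
def floatIllumDist (K : Set (E n)) (δ : ℝ) : ℝ :=
  ⨅ δ' : Ioi (0 : ℝ), bodyDist (floatingBody K δ) (polarIllumination K δ')

/-- The face of the polar `P°` with outer normal `ξ`, i.e. the set of all points of `P°` at which
`⟪ξ, ·⟫` is maximal. If `ξ` is a vertex of `P` it is a facet of `P°`. -/
def polarFacet (P : Set (E n)) (ξ : E n) : Set (E n) :=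
  {y | y ∈ polar P ∧ ∀ z ∈ polar P, ⟪ξ, z⟫ ≤ ⟪ξ, y⟫}

/-- `(F - s)°`, the polar being taken within the linear subspace parallel to the affine hull
of `F`. -/
def relPolar (F : Set (E n)) (s : E n) : Set (E n) :=
  {w | w ∈ vectorSpan ℝ F ∧ ∀ x ∈ F, ⟪x - s, w⟫ ≤ 1}

/-- `s` is a Santaló point of the `d`-dimensional convex set `F`: a point of the relative interior
of `F` which minimizes the `d`-dimensional volume of `(F - s)°`. -/
def IsSantaloPoint (d : ℕ) (F : Set (E n)) (s : E n) : Prop :=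
  s ∈ intrinsicInterior ℝ F ∧
    ∀ t ∈ intrinsicInterior ℝ F, μHE[d] (relPolar F s) ≤ μHE[d] (relPolar F t)

/-- The Santaló point of the `d`-dimensional convex body `F`. -/
def santaloPoint (d : ℕ) (F : Set (E n)) : E n :=
  Classical.epsilon (IsSantaloPoint d F)

/-- The discrete density of the normalized cone measure of `P°` at the vertex `ξ` of `P`:
`n_{P°}(ξ) = |F_ξ|_{n-1} / (n |P°|_n ‖ξ‖)`. -/
def densityPolar (P : Set (E n)) (ξ : E n) : ℝ :=
  1 / (n * (volume (polar P)).toReal) * (1 / ‖ξ‖) * (μHE[n - 1] (polarFacet P ξ)).toReal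

/-- The discrete density of the normalized cone measure of `P` at the vertex `ξ` of `P`:
`n_P(ξ) = ‖ξ‖ |(F_ξ - s(F_ξ))°|_{n-1} / (n |P|_n)`. -/
def density (P : Set (E n)) (ξ : E n) : ℝ :=
  1 / (n * (volume P).toReal) * ‖ξ‖ *
    (μHE[n - 1] (relPolar (polarFacet P ξ) (santaloPoint (n - 1) (polarFacet P ξ)))).toReal

/-- `G_c(P)`, the maximum over the vertices `ξ` of `P` of the two quantities
`(n_{P°}(ξ) - c n_P(ξ)^{1/n}) / (n_P(ξ)^{1/n} n_{P°}(ξ))` and `c / min_η n_{P°}(η)`. -/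
def Gc (P : Set (E n)) (c : ℝ) : ℝ :=
  ⨆ ξ : extremePoints ℝ P,
    max ((densityPolar P ξ - c * density P ξ ^ (1 / n : ℝ)) /
        (density P ξ ^ (1 / n : ℝ) * densityPolar P ξ))
      (c / ⨅ η : extremePoints ℝ P, densityPolar P η)

/-- `G(P) = min_{c ≥ 0} G_c(P)`. -/
def G (P : Set (E n)) : ℝ :=
  sInf (Gc P '' Ici 0)

end FloatIllum

end

noncomputable section

namespace FloatIllum

variable {n : ℕ} {P : Set (E n)}

/-! Put `θ = δ^(1/n)` and compare `δ'` with `θ` by writing `δ' = cθ`. To first order in `θ`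
everything is governed by two rates at each vertex `ξ`: `β = 1 / n_{P°}(ξ)` (`illumRate`) and `α =
n_P(ξ)^(-1/n)` (`floatRate`).

Illumination: a point `x` beyond the facet `F_ξ` of `P°` adds to `P°` at least the pyramid over
`F_ξ`, of relative volume `n_{P°}(ξ) (⟪ξ, x⟫ - 1)`, and exactly this if `x` is beyond no other
facet. So `⟪ξ, x⟫ ≤ 1 + δ'β` on the illumination body, and this is sharp
(`inner_le_of_mem_illuminationBody`, `mem_illuminationBody`).

Floating: near `ξ` the polytope is its tangent cone, so a low cap of height `s` with normal `y`
inside `F_ξ` has volume `s^n` times a multiple of `|(F_ξ - y)°|`, which the Santaló point minimizes.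
Caps of relative volume `θ^n` therefore have height at most `θα`, with equality in the Santaló
direction (`volume_cap_eq`, `density_spec`). Normals near the boundary of `F_ξ` give much larger
caps (`exists_le_volume_cap`), and inner points of segments of `P` lie within `o(θ)` of the floating
body (`eventually_smul_mem_floatingBody`); both facts come from placing a row of many balls in the
cap.

Comparison: at `ξ` the inclusion of the polar illumination body in `a` times the floating body
forces `a ≥ 1 + θ(α - cβ) - o(θ)`. Close to `ξ`, on the segment to an adjacent vertex, the floating
body loses only `o(θ)` but the polar illumination body still loses about `cβθ`, so `a ≥ 1 + θcβ -
o(θ)`. These constraints make up `G_c` (`Gc_le_iff`), and they suffice up to `o(θ)`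
(`eventually_polarIllumination_subset`, `smul_mem_polarIllumination_of_le`). Optimizing over `c`
gives `G(P)`. Its linear invariance follows from that of the limit. -/

/-! ### Volumes of cones. -/

theorem inner_div_smul {ξ x : E n} {h : ℝ} (hx : ⟪ξ, x⟫ ≠ 0) :
    ⟪ξ, (h / ⟪ξ, x⟫) • x⟫ = h := by
  rw [inner_smul_right]; field_simp

/-- The open truncated cone with apex `0` over a subset `A` of the hyperplane `⟪ξ, ·⟫ = h`. -/
def coneOver (ξ : E n) (h : ℝ) (A : Set (E n)) : Set (E n) :=
  {x | 0 < ⟪ξ, x⟫ ∧ ⟪ξ, x⟫ < h ∧ (h / ⟪ξ, x⟫) • x ∈ A}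

theorem measurableSet_coneOver (ξ : E n) (h : ℝ) {A : Set (E n)} (hA : IsClosed A) :
    MeasurableSet (coneOver ξ h A) := by
  have h1 : Measurable fun x : E n => ⟪ξ, x⟫ := by fun_prop
  have h2 : Measurable fun x : E n => (h / ⟪ξ, x⟫) • x := by fun_prop
  exact (measurableSet_lt measurable_const h1).inter
    ((measurableSet_lt h1 measurable_const).inter (h2 hA.measurableSet))

/-- The hyperplane through `t • ξ` has height `t * ‖ξ‖ ^ 2`, so its slice is the base scaled by the
ratio of this height to `h`. -/
theorem coneOver_inter_slice {ξ : E n} (hξ : ξ ≠ 0) {h : ℝ} (hh : 0 < h) {A : Set (E n)}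
    (hA : ∀ x ∈ A, ⟪ξ, x⟫ = h) (t : ℝ) :
    coneOver ξ h A ∩ (AffineSubspace.mk' (t • ξ +ᵥ (0 : E n)) (Submodule.span ℝ {ξ})ᗮ : Set (E n)) =
      if 0 < t ∧ t < h / ‖ξ‖ ^ 2 then (t * (‖ξ‖ ^ 2 / h)) • A else ∅ := by
  have hξ2 : 0 < ‖ξ‖ ^ 2 := by positivity
  have key : ∀ x : E n, x ∈ (AffineSubspace.mk' (t • ξ +ᵥ (0 : E n))
      (Submodule.span ℝ {ξ})ᗮ : Set (E n)) ↔ ⟪ξ, x⟫ = t * ‖ξ‖ ^ 2 := by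
    intro x
    rw [SetLike.mem_coe, AffineSubspace.mem_mk', Submodule.mem_orthogonal_singleton_iff_inner_right]
    simp only [vadd_eq_add, add_zero, vsub_eq_sub, inner_sub_right, inner_smul_right,
      real_inner_self_eq_norm_sq, sub_eq_zero]
  ext x
  rw [mem_inter_iff, key]
  split_ifs with ht
  · have hc : 0 < t * (‖ξ‖ ^ 2 / h) := mul_pos ht.1 (by positivity)
    rw [mem_smul_set_iff_inv_smul_mem₀ hc.ne']
    have hinv : (t * (‖ξ‖ ^ 2 / h))⁻¹ = h / (t * ‖ξ‖ ^ 2) := by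
      have := ht.1.ne'
      field_simp
    have ht2 : t * ‖ξ‖ ^ 2 < h := by
      have := ht.2
      rwa [lt_div_iff₀ hξ2] at this
    constructor
    · rintro ⟨⟨h1, h2, h3⟩, h4⟩
      rwa [hinv, ← h4]
    · intro hx
      have h4 : ⟪ξ, x⟫ = t * ‖ξ‖ ^ 2 := by
        have := hA _ hx
        have h0 : t * ‖ξ‖ ^ 2 ≠ 0 := (mul_pos ht.1 hξ2).ne'
        rw [hinv, inner_smul_right, div_mul_eq_mul_div, div_eq_iff h0] at this
        exact mul_left_cancel₀ hh.ne' this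
      refine ⟨⟨?_, ?_, ?_⟩, h4⟩
      · rw [h4]; exact mul_pos ht.1 hξ2
      · rw [h4]; exact ht2
      · rwa [h4, ← hinv]
  · simp only [mem_empty_iff_false, iff_false]
    rintro ⟨⟨h1, h2, -⟩, h4⟩
    rw [h4] at h1 h2
    exact ht ⟨pos_of_mul_pos_left h1 hξ2.le, by rwa [lt_div_iff₀ hξ2]⟩

/-- The volume of a cone: one `n`-th of the product of the base and the height. -/
theorem volume_coneOver (hn : 1 ≤ n) {ξ : E n} (hξ : ξ ≠ 0) {h : ℝ} (hh : 0 < h) {A : Set (E n)}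
    (hAc : IsClosed A) (hA : ∀ x ∈ A, ⟪ξ, x⟫ = h) :
    volume (coneOver ξ h A) = ENNReal.ofReal (h / (n * ‖ξ‖)) * μHE[n - 1] A := by
  have hξ2 : 0 < ‖ξ‖ ^ 2 := by positivity
  have hξ1 : 0 < ‖ξ‖ := by positivity
  have hn0 : (0 : ℝ) < n := by exact_mod_cast hn
  have hfin : Module.finrank ℝ (E n) = n := by simp
  rw [← InnerProductSpace.euclideanHausdorffMeasure_eq_volume (V := E n),
    EuclideanGeometry.euclideanHausdorffMeasure_eq_lintegral (0 : E n) hξ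
      (measurableSet_coneOver ξ h hAc), hfin]
  have hfun : ∀ t : ℝ, μHE[n - 1] (coneOver ξ h A ∩
      (AffineSubspace.mk' (t • ξ +ᵥ (0 : E n)) (Submodule.span ℝ {ξ})ᗮ : Set (E n))) =
      (Ioo (0 : ℝ) (h / ‖ξ‖ ^ 2)).indicator
        (fun t => ENNReal.ofReal ((t * (‖ξ‖ ^ 2 / h)) ^ (n - 1)) * μHE[n - 1] A) t := by
    intro t
    rw [coneOver_inter_slice hξ hh hA]
    by_cases ht : 0 < t ∧ t < h / ‖ξ‖ ^ 2
    · have hc : 0 < t * (‖ξ‖ ^ 2 / h) := mul_pos ht.1 (by positivity)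
      rw [if_pos ht, indicator_of_mem (show t ∈ Ioo _ _ from ht),
        Measure.euclideanHausdorffMeasure_smul₀ _ hc.ne', ENNReal.smul_def, smul_eq_mul,
        ENNReal.ofReal_pow hc.le, ENNReal.coe_pow, ← Real.enorm_eq_ofReal hc.le]
      rfl
    · rw [if_neg ht, indicator_of_notMem (show t ∉ Ioo _ _ from ht), measure_empty]
  simp_rw [hfun]
  rw [lintegral_indicator measurableSet_Ioo, lintegral_mul_const _ (by fun_prop), ← mul_assoc,
    ← ofReal_integral_eq_lintegral_ofReal, ← integral_Ioc_eq_integral_Ioo,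
    ← intervalIntegral.integral_of_le (by positivity), ← ofReal_norm,
    ← ENNReal.ofReal_mul (norm_nonneg _)]
  · congr 2
    simp_rw [mul_pow]
    rw [intervalIntegral.integral_mul_const, integral_pow]
    have h1 : n - 1 + 1 = n := Nat.sub_add_cancel hn
    have h2 : ((n - 1 : ℕ) : ℝ) + 1 = n := by rw [← Nat.cast_add_one, h1]
    rw [h2, h1, zero_pow (by omega), sub_zero]
    have h3 : (h / ‖ξ‖ ^ 2) ^ n = (h / ‖ξ‖ ^ 2) ^ (n - 1) * (h / ‖ξ‖ ^ 2) := by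
      rw [← pow_succ, h1]
    have h4 : (h / ‖ξ‖ ^ 2) ^ (n - 1) * (‖ξ‖ ^ 2 / h) ^ (n - 1) = 1 := by
      rw [← mul_pow]; field_simp; simp
    calc ‖ξ‖ * ((h / ‖ξ‖ ^ 2) ^ n / n * (‖ξ‖ ^ 2 / h) ^ (n - 1))
        = ‖ξ‖ * (((h / ‖ξ‖ ^ 2) ^ (n - 1) * (‖ξ‖ ^ 2 / h) ^ (n - 1)) * (h / ‖ξ‖ ^ 2) / n) := by
          rw [h3]; ring
      _ = h / (n * ‖ξ‖) := by rw [h4]; field_simp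
  · exact ((by fun_prop : Continuous fun t : ℝ => (t * (‖ξ‖ ^ 2 / h)) ^ (n - 1)).integrableOn_Icc
      (a := 0) (b := h / ‖ξ‖ ^ 2)).mono_set Ioo_subset_Icc_self
  · refine (ae_restrict_iff' measurableSet_Ioo).2 (Eventually.of_forall fun t ht => ?_)
    have := ht.1
    exact pow_nonneg (by positivity) _

/-! ### Lower bounds for caps from rows of balls. -/

theorem volume_ball_eq (c : E n) {r : ℝ} (hr : 0 < r) :
    volume (Metric.ball c r) = ENNReal.ofReal (r ^ n) * volume (Metric.ball (0 : E n) 1) := by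
  have := Measure.addHaar_ball_of_pos (volume : Measure (E n)) c hr
  simpa using this

/-- A set that contains `N` balls in a row has at least `N` times the volume of one of them. -/
theorem card_mul_volume_ball_le {A : Set (E n)} {c k : E n} {r : ℝ} (hr : 0 < r)
    (hk : 2 * r ≤ ‖k‖) (N : ℕ) (hA : ∀ i < N, Metric.ball (c + (i : ℝ) • k) r ⊆ A) :
    ENNReal.ofReal (N * r ^ n) * volume (Metric.ball (0 : E n) 1) ≤ volume A := by
  have hdisj : PairwiseDisjoint (Finset.range N : Set ℕ)
      fun i : ℕ => Metric.ball (c + (i : ℝ) • k) r := by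
    intro i _ j _ hij
    refine Metric.ball_disjoint_ball ?_
    have h1 : (1 : ℝ) ≤ |(i : ℝ) - j| := by
      have : (1 : ℤ) ≤ |(i : ℤ) - j| := Int.one_le_abs (by omega)
      exact_mod_cast this
    rw [dist_eq_norm, add_sub_add_left_eq_sub, ← sub_smul, norm_smul, Real.norm_eq_abs]
    nlinarith [norm_nonneg k]
  have h2 : volume (⋃ i ∈ Finset.range N, Metric.ball (c + (i : ℝ) • k) r) ≤ volume A :=
    measure_mono (iUnion₂_subset fun i hi => hA i (Finset.mem_range.1 hi))
  rw [measure_biUnion_finset hdisj fun _ _ => Metric.isOpen_ball.measurableSet] at h2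
  simp_rw [volume_ball_eq _ hr] at h2
  rw [Finset.sum_const, Finset.card_range, nsmul_eq_mul, ← mul_assoc] at h2
  rwa [ENNReal.ofReal_mul (by positivity), ENNReal.ofReal_natCast]

theorem exists_norm_eq (hn : 1 ≤ n) {r : ℝ} (hr : 0 ≤ r) : ∃ k : E n, ‖k‖ = r := by
  refine ⟨EuclideanSpace.single ⟨0, hn⟩ r, ?_⟩
  simp [abs_of_nonneg hr]

/-- A lower bound for the volume of a cap of a convex set that contains a ball and a row of points
high up in the cap. -/
theorem card_mul_le_volume_cap {K : Set (E n)} (hK : Convex ℝ K) {ρ : ℝ} (hρ : 0 < ρ)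
    (hball : Metric.ball 0 ρ ⊆ K) {u p k : E n} {t τ : ℝ} (hτ : 0 < τ) (hτ1 : τ ≤ 1) (N : ℕ)
    (hp : ∀ i < N, p + (i : ℝ) • k ∈ K) (hk : τ * ρ ≤ (1 - τ) * ‖k‖)
    (ht : ∀ i < N, t ≤ (1 - τ) * ⟪u, p + (i : ℝ) • k⟫) :
    ENNReal.ofReal (N * (τ * (ρ / 2)) ^ n) * volume (Metric.ball (0 : E n) 1) ≤
      volume (K ∩ {y | t ≤ ⟪u, y⟫}) := by
  -- The ball of radius `ρ / 2` about `b` lies in `K` and in the half-space `0 ≤ ⟪u, ·⟫`. Adding `τ`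
  -- times it to `(1 - τ) • q` fattens the point without lowering it.
  set b : E n := (ρ / 2) • (‖u‖⁻¹ • u) with hb
  have hunit : ‖(‖u‖⁻¹ • u : E n)‖ ≤ 1 := by
    rw [norm_smul, norm_inv, norm_norm]; exact inv_mul_le_one
  have hbn : ‖b‖ ≤ ρ / 2 := by
    rw [hb, norm_smul, Real.norm_of_nonneg (by positivity)]
    nlinarith
  have hub : ⟪u, b⟫ = ρ / 2 * ‖u‖ := by
    rw [hb, inner_smul_right, inner_smul_right, real_inner_self_eq_norm_sq]
    by_cases hu : ‖u‖ = 0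
    · simp [hu]
    · field_simp
  refine card_mul_volume_ball_le (c := (1 - τ) • p + τ • b) (k := (1 - τ) • k) (by positivity)
    ?_ N fun i hi x hx => ?_
  · rw [norm_smul, Real.norm_of_nonneg (by linarith)]; linarith
  · set q := p + (i : ℝ) • k with hq
    set e : E n := τ⁻¹ • (x - (1 - τ) • q) with he
    have hxe : x = (1 - τ) • q + τ • e := by
      rw [he, smul_smul, mul_inv_cancel₀ hτ.ne', one_smul]; abel
    have heb : ‖e - b‖ < ρ / 2 := by
      have h1 : x - ((1 - τ) • p + τ • b + (i : ℝ) • (1 - τ) • k) = τ • (e - b) := by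
        rw [hxe, hq]; module
      rw [mem_ball_iff_norm, h1, norm_smul, Real.norm_of_nonneg hτ.le] at hx
      exact lt_of_mul_lt_mul_left hx hτ.le
    have heK : e ∈ K := hball (by
      rw [mem_ball_zero_iff]
      calc ‖e‖ = ‖e - b + b‖ := by rw [sub_add_cancel]
        _ ≤ ‖e - b‖ + ‖b‖ := norm_add_le _ _
        _ < ρ := by linarith)
    have hue : 0 ≤ ⟪u, e⟫ := by
      have h2 : ⟪u, e⟫ = ⟪u, b⟫ + ⟪u, e - b⟫ := by rw [← inner_add_right]; congr 1; abel
      have h3 := (abs_le.1 (abs_real_inner_le_norm u (e - b))).1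
      rw [h2, hub]
      nlinarith [norm_nonneg u]
    refine ⟨?_, ?_⟩
    · rw [hxe]
      exact hK (hp i hi) heK (by linarith) hτ.le (by ring)
    · rw [mem_ofPred_eq, hxe, inner_add_right, inner_smul_right, inner_smul_right]
      have := ht i hi
      have := mul_nonneg hτ.le hue
      linarith

/-! ### Hyperplanes, separation and polars. -/

theorem volume_hyperplane {u : E n} (hu : u ≠ 0) (t : ℝ) : volume {x : E n | ⟪u, x⟫ = t} = 0 := by
  have huu : ⟪u, u⟫ ≠ 0 := by simpa using hu
  set S : AffineSubspace ℝ (E n) :=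
    AffineSubspace.mk' ((t / ⟪u, u⟫) • u) (Submodule.span ℝ {u})ᗮ with hS
  have hmem : ∀ x, x ∈ S ↔ ⟪u, x⟫ = t := by
    intro x
    rw [hS, AffineSubspace.mem_mk', Submodule.mem_orthogonal_singleton_iff_inner_right, vsub_eq_sub,
      inner_sub_right, inner_smul_right, div_mul_cancel₀ _ huu, sub_eq_zero]
  have hne : S ≠ ⊤ := by
    intro h
    have h1 : ⟪u, ((t + 1) / ⟪u, u⟫) • u⟫ = t := (hmem _).1 (h ▸ AffineSubspace.mem_top _ _ _)
    rw [inner_smul_right, div_mul_cancel₀ _ huu] at h1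
    linarith
  rw [show {x : E n | ⟪u, x⟫ = t} = (S : Set (E n)) from Set.ext fun x => (hmem x).symm]
  exact Measure.addHaar_affineSubspace _ _ hne

theorem exists_inner_separation {K : Set (E n)} (hK : Convex ℝ K) (hKc : IsClosed K) {x : E n}
    (hx : x ∉ K) : ∃ (v : E n) (s : ℝ), (∀ a ∈ K, ⟪a, v⟫ < s) ∧ s < ⟪x, v⟫ := by
  obtain ⟨f, s, hf, hs⟩ := geometric_hahn_banach_closed_point hK hKc hx
  refine ⟨(InnerProductSpace.toDual ℝ (E n)).symm f, s, fun a ha => ?_, ?_⟩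
  · rw [real_inner_comm, InnerProductSpace.toDual_symm_apply]; exact hf a ha
  · rwa [real_inner_comm, InnerProductSpace.toDual_symm_apply]

theorem convex_inner_le (u : E n) (c : ℝ) : Convex ℝ {x : E n | ⟪x, u⟫ ≤ c} := by
  intro a ha b hb s t hs ht hst
  have h : s * ⟪a, u⟫ + t * ⟪b, u⟫ ≤ s * c + t * c :=
    add_le_add (mul_le_mul_of_nonneg_left ha hs) (mul_le_mul_of_nonneg_left hb ht)
  rw [mem_ofPred_eq, inner_add_left, real_inner_smul_left, real_inner_smul_left]
  rwa [← add_mul, hst, one_mul] at h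

theorem convex_polar (K : Set (E n)) : Convex ℝ (polar K) := by
  intro x hx y hy a b ha hb hab z hz
  rw [inner_add_right, inner_smul_right, inner_smul_right]
  nlinarith [hx z hz, hy z hz]

theorem isClosed_polar (K : Set (E n)) : IsClosed (polar K) := by
  have : polar K = ⋂ x ∈ K, {y : E n | ⟪x, y⟫ ≤ 1} := by ext; simp [polar]
  rw [this]
  exact isClosed_biInter fun x _ => isClosed_le (by fun_prop) (by fun_prop)

theorem zero_mem_polar (K : Set (E n)) : (0 : E n) ∈ polar K := fun x _ => by simp

/-- The nontrivial half of the bipolar theorem: a functional separating `x` from `K` has a positive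
bound on `K` because `0 ∈ K`, and dividing by it gives a point of the polar. -/
theorem mem_of_forall_polar {K : Set (E n)} (hK : Convex ℝ K) (hKc : IsClosed K)
    (h0 : (0 : E n) ∈ K) {x : E n} (hx : ∀ y ∈ polar K, ⟪x, y⟫ ≤ 1) : x ∈ K := by
  by_contra hxK
  obtain ⟨v, s, hv, hs⟩ := exists_inner_separation hK hKc hxK
  have hs0 : 0 < s := by simpa using hv 0 h0
  have h1 := hx (s⁻¹ • v) fun a ha => by
    rw [inner_smul_right, inv_mul_le_iff₀ hs0, mul_one]; exact (hv a ha).le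
  rw [inner_smul_right, inv_mul_le_iff₀ hs0, mul_one] at h1
  linarith

/-! ### Symmetric polytopes, their vertices and their polars. -/

namespace IsSymmPolytope

theorem isCompact (hP : IsSymmPolytope P) : IsCompact P := by
  obtain ⟨V, hV, rfl⟩ := hP.exists_finite
  exact hV.isCompact_convexHull ℝ

theorem convex (hP : IsSymmPolytope P) : Convex ℝ P := by
  obtain ⟨V, hV, rfl⟩ := hP.exists_finite
  exact convex_convexHull ℝ V

theorem isClosed (hP : IsSymmPolytope P) : IsClosed P := hP.isCompact.isClosed

theorem finite_extremePoints (hP : IsSymmPolytope P) : (extremePoints ℝ P).Finite := by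
  obtain ⟨V, hV, rfl⟩ := hP.exists_finite
  exact hV.subset extremePoints_convexHull_subset

theorem convexHull_extremePoints (hP : IsSymmPolytope P) :
    convexHull ℝ (extremePoints ℝ P) = P := by
  have h := closure_convexHull_extremePoints hP.isCompact hP.convex
  rwa [(hP.finite_extremePoints.isClosed_convexHull ℝ).closure_eq] at h

theorem exists_ball_subset (hP : IsSymmPolytope P) : ∃ ρ > 0, Metric.ball (0 : E n) ρ ⊆ P := by
  obtain ⟨x, hx⟩ := hP.interior_nonempty
  have h0 : (0 : E n) ∈ interior P := by
    have := hP.convex.combo_interior_self_mem_interior hx (hP.symm x (interior_subset hx))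
      (a := 1 / 2) (b := 1 / 2) (by norm_num) (by norm_num) (by norm_num)
    simpa using this
  obtain ⟨ρ, hρ, h⟩ := Metric.isOpen_iff.1 isOpen_interior 0 h0
  exact ⟨ρ, hρ, h.trans interior_subset⟩

theorem zero_mem (hP : IsSymmPolytope P) : (0 : E n) ∈ P := by
  obtain ⟨ρ, hρ, h⟩ := hP.exists_ball_subset
  exact h (Metric.mem_ball_self hρ)

theorem exists_norm_le (hP : IsSymmPolytope P) : ∃ R > 0, ∀ x ∈ P, ‖x‖ ≤ R := by
  obtain ⟨R, hR, h⟩ := hP.isCompact.isBounded.exists_pos_norm_le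
  exact ⟨R, hR, h⟩

theorem neg_mem_extremePoints (hP : IsSymmPolytope P) {ξ : E n} (hξ : ξ ∈ extremePoints ℝ P) :
    -ξ ∈ extremePoints ℝ P := by
  rw [mem_extremePoints] at hξ ⊢
  refine ⟨hP.symm ξ hξ.1, fun x hx y hy h => ?_⟩
  have h1 : ξ ∈ openSegment ℝ (-x) (-y) := by
    obtain ⟨a, b, ha, hb, hab, h⟩ := h
    refine ⟨a, b, ha, hb, hab, ?_⟩
    rw [smul_neg, smul_neg, ← neg_add, h, neg_neg]
  have h2 := hξ.2 _ (hP.symm x hx) _ (hP.symm y hy) h1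
  exact ⟨by rw [← h2.1, neg_neg], by rw [← h2.2, neg_neg]⟩

theorem extremePoint_ne_zero (hn : 1 ≤ n) (hP : IsSymmPolytope P) {ξ : E n}
    (hξ : ξ ∈ extremePoints ℝ P) : ξ ≠ 0 := by
  rintro rfl
  obtain ⟨ρ, hρ, hb⟩ := hP.exists_ball_subset
  obtain ⟨k, hk⟩ := exists_norm_eq hn (half_pos hρ).le
  have hkP : k ∈ P := hb (by rw [mem_ball_zero_iff, hk]; linarith)
  have h1 := ((mem_extremePoints.1 hξ).2 k hkP (-k) (hP.symm k hkP)
    ⟨1 / 2, 1 / 2, by norm_num, by norm_num, by norm_num, by simp⟩).1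
  rw [h1, norm_zero] at hk
  linarith

theorem neg_ne_extremePoint (hn : 1 ≤ n) (hP : IsSymmPolytope P) {ξ : E n}
    (hξ : ξ ∈ extremePoints ℝ P) : -ξ ≠ ξ := by
  intro h
  have h2 : (2 : ℝ) • ξ = 0 := by rw [two_smul]; nth_rewrite 1 [← h]; exact neg_add_cancel ξ
  exact hP.extremePoint_ne_zero hn hξ ((smul_eq_zero.1 h2).resolve_left two_ne_zero)

theorem mem_polar_iff (hP : IsSymmPolytope P) {y : E n} :
    y ∈ polar P ↔ ∀ ξ ∈ extremePoints ℝ P, ⟪ξ, y⟫ ≤ 1 := by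
  refine ⟨fun h ξ hξ => h ξ hξ.1, fun h x hx => ?_⟩
  rw [← hP.convexHull_extremePoints] at hx
  exact convexHull_min h (convex_inner_le _ _) hx

theorem inner_polar_ge (hP : IsSymmPolytope P) {x y : E n} (hx : x ∈ P) (hy : y ∈ polar P) :
    -1 ≤ ⟪x, y⟫ := by
  have := hy _ (hP.symm x hx)
  rw [inner_neg_left] at this
  linarith

theorem exists_ball_subset_polar (hP : IsSymmPolytope P) :
    ∃ ρ > 0, Metric.ball (0 : E n) ρ ⊆ polar P := by
  obtain ⟨R, hR, h⟩ := hP.exists_norm_le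
  refine ⟨R⁻¹, by positivity, fun y hy x hx => ?_⟩
  rw [mem_ball_zero_iff] at hy
  calc ⟪x, y⟫ ≤ ‖x‖ * ‖y‖ := real_inner_le_norm x y
    _ ≤ R * R⁻¹ := mul_le_mul (h x hx) hy.le (norm_nonneg _) hR.le
    _ = 1 := mul_inv_cancel₀ hR.ne'

theorem exists_polar_norm_le (hP : IsSymmPolytope P) : ∃ R > 0, ∀ y ∈ polar P, ‖y‖ ≤ R := by
  obtain ⟨ρ, hρ, hb⟩ := hP.exists_ball_subset
  refine ⟨2 / ρ, by positivity, fun y hy => ?_⟩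
  by_cases h0 : y = 0
  · rw [h0, norm_zero]; positivity
  have hy0 : 0 < ‖y‖ := norm_pos_iff.2 h0
  have h1 := hy ((ρ / 2 * ‖y‖⁻¹) • y) (hb (by
    rw [mem_ball_zero_iff, norm_smul, Real.norm_of_nonneg (by positivity), mul_assoc,
      inv_mul_cancel₀ hy0.ne']
    linarith))
  rw [real_inner_smul_left, real_inner_self_eq_norm_sq] at h1
  rw [le_div_iff₀ hρ]
  have : ρ / 2 * ‖y‖⁻¹ * ‖y‖ ^ 2 = ρ / 2 * ‖y‖ := by field_simp
  linarith

theorem isCompact_polar (hP : IsSymmPolytope P) : IsCompact (polar P) := by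
  obtain ⟨R, hR, h⟩ := hP.exists_polar_norm_le
  exact (isCompact_closedBall (0 : E n) R).of_isClosed_subset (isClosed_polar P)
    fun y hy => mem_closedBall_zero_iff.2 (h y hy)

theorem volume_pos (hP : IsSymmPolytope P) : 0 < volume P := by
  obtain ⟨ρ, hρ, hb⟩ := hP.exists_ball_subset
  exact (Metric.measure_ball_pos _ _ hρ).trans_le (measure_mono hb)

theorem volume_polar_pos (hP : IsSymmPolytope P) : 0 < volume (polar P) := by
  obtain ⟨ρ, hρ, hb⟩ := hP.exists_ball_subset_polar
  exact (Metric.measure_ball_pos _ _ hρ).trans_le (measure_mono hb)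

theorem volume_toReal_pos (hP : IsSymmPolytope P) : 0 < (volume P).toReal :=
  ENNReal.toReal_pos hP.volume_pos.ne' hP.isCompact.measure_lt_top.ne

theorem volume_polar_toReal_pos (hP : IsSymmPolytope P) : 0 < (volume (polar P)).toReal :=
  ENNReal.toReal_pos hP.volume_polar_pos.ne' hP.isCompact_polar.measure_lt_top.ne

theorem extremePoints_nonempty (hP : IsSymmPolytope P) : (extremePoints ℝ P).Nonempty :=
  hP.isCompact.extremePoints_nonempty ⟨0, hP.zero_mem⟩

/-- For every linear functional there is a vertex at which it is maximal. -/
theorem exists_extremePoint_max (hP : IsSymmPolytope P) (u : E n) :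
    ∃ ξ ∈ extremePoints ℝ P, ∀ x ∈ P, ⟪x, u⟫ ≤ ⟪ξ, u⟫ := by
  obtain ⟨ξ, hξ, h⟩ := Set.exists_max_image _ (fun ξ : E n => ⟪ξ, u⟫) hP.finite_extremePoints
    hP.extremePoints_nonempty
  refine ⟨ξ, hξ, fun x hx => ?_⟩
  rw [← hP.convexHull_extremePoints] at hx
  exact convexHull_min h (convex_inner_le _ _) hx

theorem exists_inner_pos (hP : IsSymmPolytope P) {u : E n} (hu : u ≠ 0) :
    ∃ ξ ∈ extremePoints ℝ P, 0 < ⟪ξ, u⟫ := by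
  obtain ⟨ρ, hρ, hb⟩ := hP.exists_ball_subset
  obtain ⟨ξ, hξ, h⟩ := hP.exists_extremePoint_max u
  refine ⟨ξ, hξ, ?_⟩
  have hu0 : 0 < ‖u‖ := norm_pos_iff.2 hu
  have h1 := h ((ρ / 2 * ‖u‖⁻¹) • u) (hb (by
    rw [mem_ball_zero_iff, norm_smul, Real.norm_of_nonneg (by positivity), mul_assoc,
      inv_mul_cancel₀ hu0.ne']
    linarith))
  rw [real_inner_smul_left, real_inner_self_eq_norm_sq] at h1
  exact lt_of_lt_of_le (by positivity) h1

end IsSymmPolytope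

/-! ### Facets of the polar. -/

/-- The points of the facet of the polar of `P` with outer normal `ξ` which satisfy all other
facet inequalities with margin `r`. -/
def innerFacet (P : Set (E n)) (ξ : E n) (r : ℝ) : Set (E n) :=
  {y | ⟪ξ, y⟫ = 1 ∧ ∀ η ∈ extremePoints ℝ P, η ≠ ξ → ⟪η, y⟫ ≤ 1 - r}

namespace IsSymmPolytope

/-- Every vertex of a symmetric polytope is exposed. -/
theorem exists_mem_innerFacet (hn : 1 ≤ n) (hP : IsSymmPolytope P) {ξ : E n}
    (hξ : ξ ∈ extremePoints ℝ P) : ∃ r, 0 < r ∧ r ≤ 1 ∧ (innerFacet P ξ r).Nonempty := by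
  have hfin : (extremePoints ℝ P \ {ξ}).Finite := hP.finite_extremePoints.sdiff
  have hnot : ξ ∉ convexHull ℝ (extremePoints ℝ P \ {ξ}) := by
    have := (hP.convex.mem_extremePoints_iff_mem_sdiff_convexHull_sdiff).1 hξ
    intro h
    exact this.2 (convexHull_mono (sdiff_subset_sdiff_left extremePoints_subset) h)
  obtain ⟨v, s, hv, hs⟩ := exists_inner_separation (convex_convexHull ℝ _)
    (hfin.isClosed_convexHull ℝ) hnot
  have hne := hP.neg_ne_extremePoint hn hξ
  -- By symmetry `-ξ` is another vertex; comparing it with `ξ` forces `⟪ξ, v⟫ > 0`, so `v` can be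
  -- scaled into the hyperplane of the facet.
  have hneg := hv _ (subset_convexHull ℝ _ ⟨hP.neg_mem_extremePoints hξ, hne⟩)
  rw [inner_neg_left] at hneg
  set a := ⟪ξ, v⟫ with ha
  have ha0 : 0 < a := by linarith
  refine ⟨min 1 (1 - s / a), lt_min one_pos ?_, min_le_left _ _, a⁻¹ • v, ?_, fun η hη hηξ => ?_⟩
  · rw [sub_pos, div_lt_one ha0]; exact hs
  · rw [inner_smul_right, ← ha, inv_mul_cancel₀ ha0.ne']
  · have h1 := hv _ (subset_convexHull ℝ _ ⟨hη, hηξ⟩)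
    have h2 : ⟪η, a⁻¹ • v⟫ ≤ s / a := by
      rw [inner_smul_right, inv_mul_eq_div]
      exact (div_lt_div_of_pos_right h1 ha0).le
    have := min_le_right 1 (1 - s / a)
    linarith

theorem innerFacet_subset_polar (hP : IsSymmPolytope P) {ξ : E n} {r : ℝ} (hr : 0 ≤ r) :
    innerFacet P ξ r ⊆ polar P := by
  intro y hy
  rw [hP.mem_polar_iff]
  intro η hη
  by_cases h : η = ξ
  · rw [h, hy.1]
  · linarith [hy.2 η hη h]

theorem mem_polarFacet_iff (hn : 1 ≤ n) (hP : IsSymmPolytope P) {ξ : E n}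
    (hξ : ξ ∈ extremePoints ℝ P) {y : E n} :
    y ∈ polarFacet P ξ ↔ y ∈ polar P ∧ ⟪ξ, y⟫ = 1 := by
  refine ⟨fun h => ⟨h.1, le_antisymm (h.1 ξ hξ.1) ?_⟩, fun h => ⟨h.1, fun z hz => ?_⟩⟩
  · obtain ⟨r, hr, -, w, hw⟩ := hP.exists_mem_innerFacet hn hξ
    exact hw.1 ▸ h.2 w (hP.innerFacet_subset_polar hr.le hw)
  · rw [h.2]; exact hz ξ hξ.1

theorem innerFacet_subset_polarFacet (hn : 1 ≤ n) (hP : IsSymmPolytope P) {ξ : E n}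
    (hξ : ξ ∈ extremePoints ℝ P) {r : ℝ} (hr : 0 ≤ r) : innerFacet P ξ r ⊆ polarFacet P ξ :=
  fun _ hy => (hP.mem_polarFacet_iff hn hξ).2 ⟨hP.innerFacet_subset_polar hr hy, hy.1⟩

theorem isClosed_polarFacet (hn : 1 ≤ n) (hP : IsSymmPolytope P) {ξ : E n}
    (hξ : ξ ∈ extremePoints ℝ P) : IsClosed (polarFacet P ξ) := by
  have : polarFacet P ξ = polar P ∩ {y | ⟪ξ, y⟫ = 1} :=
    Set.ext fun y => hP.mem_polarFacet_iff hn hξ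
  rw [this]
  exact (isClosed_polar P).inter (isClosed_eq (by fun_prop) (by fun_prop))

/-- A facet of the polar contains all points of its hyperplane near an inner point. -/
theorem exists_ball_inter_subset_polarFacet (hn : 1 ≤ n) (hP : IsSymmPolytope P) {ξ : E n}
    (hξ : ξ ∈ extremePoints ℝ P) {r : ℝ} (hr : 0 < r) : ∃ ε > 0, ∀ w ∈ innerFacet P ξ r,
      ∀ y, ‖y - w‖ ≤ ε → ⟪ξ, y⟫ = 1 → y ∈ polarFacet P ξ := by
  obtain ⟨R, hR, h⟩ := hP.exists_norm_le
  refine ⟨r / R, by positivity, fun w hw y hy hξy => ?_⟩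
  rw [hP.mem_polarFacet_iff hn hξ, hP.mem_polar_iff]
  refine ⟨fun η hη => ?_, hξy⟩
  by_cases hηξ : η = ξ
  · rw [hηξ, hξy]
  · have h1 : ⟪η, y⟫ = ⟪η, w⟫ + ⟪η, y - w⟫ := by rw [← inner_add_right]; congr 1; abel
    have h2 : ⟪η, y - w⟫ ≤ r := calc
      ⟪η, y - w⟫ ≤ ‖η‖ * ‖y - w‖ := real_inner_le_norm _ _
      _ ≤ R * (r / R) := mul_le_mul (h η hη.1) hy (norm_nonneg _) hR.le
      _ = r := by field_simp
    linarith [hw.2 η hη hηξ]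

/-- An inner point of the facet can be moved a little in every direction orthogonal to `ξ` without
leaving the facet. -/
theorem mem_vectorSpan_polarFacet (hn : 1 ≤ n) (hP : IsSymmPolytope P) {ξ : E n}
    (hξ : ξ ∈ extremePoints ℝ P) {w : E n} :
    w ∈ vectorSpan ℝ (polarFacet P ξ) ↔ ⟪ξ, w⟫ = 0 := by
  constructor
  · intro hw
    have hle : vectorSpan ℝ (polarFacet P ξ) ≤ (Submodule.span ℝ {ξ})ᗮ := by
      rw [vectorSpan_def, Submodule.span_le]
      rintro _ ⟨a, ha, b, hb, rfl⟩
      rw [SetLike.mem_coe, Submodule.mem_orthogonal_singleton_iff_inner_right]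
      simp only [vsub_eq_sub]
      rw [inner_sub_right, ((hP.mem_polarFacet_iff hn hξ).1 ha).2,
        ((hP.mem_polarFacet_iff hn hξ).1 hb).2, sub_self]
    exact Submodule.mem_orthogonal_singleton_iff_inner_right.1 (hle hw)
  · intro hw
    obtain ⟨r, hr, -, y, hy⟩ := hP.exists_mem_innerFacet hn hξ
    obtain ⟨ε, hε, hb⟩ := hP.exists_ball_inter_subset_polarFacet hn hξ hr
    by_cases h0 : w = 0
    · rw [h0]; exact Submodule.zero_mem _
    have hw0 : 0 < ‖w‖ := norm_pos_iff.2 h0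
    have h1 : y + (ε / ‖w‖) • w ∈ polarFacet P ξ := by
      refine hb y hy _ ?_ ?_
      · rw [add_sub_cancel_left, norm_smul, Real.norm_of_nonneg (by positivity)]
        field_simp
        rfl
      · rw [inner_add_right, inner_smul_right, hw, hy.1]; simp
    have h2 := vsub_mem_vectorSpan ℝ h1 (hP.innerFacet_subset_polarFacet hn hξ hr.le hy)
    rw [vsub_eq_sub, add_sub_cancel_left] at h2
    exact (Submodule.smul_mem_iff _ (by positivity)).1 h2

/-- This makes minimizers found in `innerFacet` eligible as Santaló points. -/
theorem innerFacet_subset_intrinsicInterior (hn : 1 ≤ n) (hP : IsSymmPolytope P) {ξ : E n}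
    (hξ : ξ ∈ extremePoints ℝ P) {r : ℝ} (hr : 0 < r) :
    innerFacet P ξ r ⊆ intrinsicInterior ℝ (polarFacet P ξ) := by
  intro w hw
  have hwF := hP.innerFacet_subset_polarFacet hn hξ hr.le hw
  obtain ⟨ε, hε, hb⟩ := hP.exists_ball_inter_subset_polarFacet hn hξ hr
  rw [mem_intrinsicInterior]
  refine ⟨⟨w, subset_affineSpan ℝ _ hwF⟩, ?_, rfl⟩
  rw [mem_interior]
  refine ⟨Metric.ball _ ε, fun z hz => ?_, Metric.isOpen_ball, Metric.mem_ball_self hε⟩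
  have h1 : (z : E n) -ᵥ w ∈ vectorSpan ℝ (polarFacet P ξ) := by
    rw [← direction_affineSpan]
    exact AffineSubspace.vsub_mem_direction z.2 (subset_affineSpan ℝ _ hwF)
  rw [hP.mem_vectorSpan_polarFacet hn hξ, vsub_eq_sub, inner_sub_right, hw.1, sub_eq_zero] at h1
  refine hb w hw z ?_ h1
  rw [Metric.mem_ball, Subtype.dist_eq, dist_eq_norm] at hz
  exact hz.le

/-- Every facet of the polar meets another facet. -/
theorem exists_adjacent (hn : 2 ≤ n) (hP : IsSymmPolytope P) {ξ : E n}
    (hξ : ξ ∈ extremePoints ℝ P) : ∃ η ∈ extremePoints ℝ P, η ≠ ξ ∧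
      ∃ w ∈ polar P, ⟪ξ, w⟫ = 1 ∧ ⟪η, w⟫ = 1 := by
  obtain ⟨r, hr, -, w, hw⟩ := hP.exists_mem_innerFacet (by omega) hξ
  have hξ0 := hP.extremePoint_ne_zero (by omega) hξ
  obtain ⟨d, hd, hd0⟩ : ∃ d : E n, ⟪ξ, d⟫ = 0 ∧ d ≠ 0 := by
    have hne : (Submodule.span ℝ {ξ})ᗮ ≠ ⊥ := by
      intro h
      have h1 := (Submodule.span ℝ {ξ}).finrank_add_finrank_orthogonal
      rw [h, finrank_bot, finrank_span_singleton hξ0] at h1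
      simp at h1
      omega
    obtain ⟨d, hd, hd0⟩ := Submodule.exists_mem_ne_zero_of_ne_bot hne
    exact ⟨d, Submodule.mem_orthogonal_singleton_iff_inner_right.1 hd, hd0⟩
  obtain ⟨η₁, hη₁, hpos⟩ := hP.exists_inner_pos hd0
  -- Ratio test: moving from the inner point `w` along `d`, within the hyperplane of `ξ`, the
  -- constraint of `η` is the first to become tight.
  obtain ⟨η, ⟨hη, hηd⟩, hmin⟩ := Set.exists_min_image {η ∈ extremePoints ℝ P | 0 < ⟪η, d⟫}
    (fun η => (1 - ⟪η, w⟫) / ⟪η, d⟫) (hP.finite_extremePoints.subset fun x hx => hx.1)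
    ⟨η₁, hη₁, hpos⟩
  have hηξ : η ≠ ξ := by rintro rfl; exact hηd.ne' hd
  have hwP := hP.innerFacet_subset_polar hr.le hw
  set t := (1 - ⟪η, w⟫) / ⟪η, d⟫ with ht
  have ht0 : 0 ≤ t := div_nonneg (by linarith [hwP η hη.1]) hηd.le
  refine ⟨η, hη, hηξ, w + t • d, hP.mem_polar_iff.2 fun ζ hζ => ?_, ?_, ?_⟩
  · rw [inner_add_right, inner_smul_right]
    rcases le_or_gt ⟪ζ, d⟫ 0 with h | h
    · nlinarith [hwP ζ hζ.1]
    · have := hmin ζ ⟨hζ, h⟩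
      rw [le_div_iff₀ h] at this
      linarith
  · rw [inner_add_right, inner_smul_right, hd, hw.1]; simp
  · rw [inner_add_right, inner_smul_right, ht, div_mul_cancel₀ _ hηd.ne']; ring

end IsSymmPolytope

/-! ### Pyramids over facets and the illumination body. -/

theorem measurableSet_halfSpace (u : E n) (t : ℝ) : MeasurableSet {x : E n | t ≤ ⟪u, x⟫} :=
  (isClosed_le continuous_const (by fun_prop)).measurableSet

theorem volume_preimage_sub_left (c : E n) {A : Set (E n)} (hA : MeasurableSet A) :
    volume ((fun x => c - x) ⁻¹' A) = volume A :=
  (Measure.measurePreserving_sub_left (volume : Measure (E n)) c).measure_preimage hA.nullMeasurableSet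

theorem isometry_sub_left (c : E n) : Isometry fun x : E n => c - x :=
  Isometry.of_dist_eq fun x y => dist_sub_left c x y

/-- The pyramid with base `F` and apex `x`, without base and apex. -/
def pyramid (F : Set (E n)) (x : E n) : Set (E n) :=
  {p | ∃ y ∈ F, ∃ s ∈ Ioo (0 : ℝ) 1, p = (1 - s) • x + s • y}

/-- The reflection `p ↦ x - p` moves the apex to `0`, which makes the cone volume formula
applicable. -/
theorem pyramid_eq {F : Set (E n)} {ξ x : E n} (hF : ∀ y ∈ F, ⟪ξ, y⟫ = 1) (hx : 1 < ⟪ξ, x⟫) :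
    pyramid F x = (fun p => x - p) ⁻¹' coneOver ξ (⟪ξ, x⟫ - 1) ((fun y => x - y) '' F) := by
  have hh : 0 < ⟪ξ, x⟫ - 1 := by linarith
  ext p
  constructor
  · rintro ⟨y, hy, s, hs, rfl⟩
    have h1 : x - ((1 - s) • x + s • y) = s • (x - y) := by module
    have h2 : ⟪ξ, s • (x - y)⟫ = s * (⟪ξ, x⟫ - 1) := by
      rw [inner_smul_right, inner_sub_right, hF y hy]
    rw [mem_preimage, h1]
    refine ⟨?_, ?_, y, hy, ?_⟩
    · rw [h2]; exact mul_pos hs.1 hh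
    · rw [h2]; nlinarith [hs.2]
    · rw [h2, smul_smul]
      have : (⟪ξ, x⟫ - 1) / (s * (⟪ξ, x⟫ - 1)) * s = 1 := by
        have := hs.1.ne'
        field_simp
      rw [this, one_smul]
  · rintro ⟨h1, h2, y, hy, h3⟩
    set t := ⟪ξ, x - p⟫ with ht
    refine ⟨y, hy, t / (⟪ξ, x⟫ - 1), ⟨by positivity, by rwa [div_lt_one hh]⟩, ?_⟩
    have h4 : (t / (⟪ξ, x⟫ - 1)) • (x - y) = x - p := by
      simp only at h3
      rw [h3, smul_smul]
      have : t / (⟪ξ, x⟫ - 1) * ((⟪ξ, x⟫ - 1) / t) = 1 := by field_simp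
      rw [this, one_smul]
    have h5 : p = x - (t / (⟪ξ, x⟫ - 1)) • (x - y) := by rw [h4]; abel
    rw [h5]
    module

namespace IsSymmPolytope

/-- The cone over the facet lies in the compact set `polar P`, and its volume is a positive multiple
of the measure of the facet. -/
theorem euclideanHausdorffMeasure_polarFacet_ne_top (hn : 1 ≤ n) (hP : IsSymmPolytope P)
    {ξ : E n} (hξ : ξ ∈ extremePoints ℝ P) : μHE[n - 1] (polarFacet P ξ) ≠ ⊤ := by
  have hξ0 := hP.extremePoint_ne_zero hn hξ
  have h := volume_coneOver hn hξ0 one_pos (hP.isClosed_polarFacet hn hξ)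
    fun x hx => ((hP.mem_polarFacet_iff hn hξ).1 hx).2
  intro htop
  have hc : 0 < 1 / (n * ‖ξ‖) := by
    have := norm_pos_iff.2 hξ0
    have : (0 : ℝ) < n := by exact_mod_cast hn
    positivity
  rw [htop, ENNReal.mul_top (ENNReal.ofReal_pos.2 hc).ne'] at h
  have hsub : coneOver ξ 1 (polarFacet P ξ) ⊆ polar P := by
    rintro x ⟨h1, h2, h3⟩
    have := (convex_polar P) (zero_mem_polar P) h3.1 (sub_nonneg.2 h2.le) h1.le (by ring)
    rwa [smul_zero, zero_add, smul_smul, mul_one_div_cancel h1.ne', one_smul] at this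
  exact (lt_of_le_of_lt (measure_mono hsub) hP.isCompact_polar.measure_lt_top).ne h

/-- The cone over the facet contains a nonempty open set, around half of an inner point of the
facet. -/
theorem euclideanHausdorffMeasure_polarFacet_ne_zero (hn : 1 ≤ n) (hP : IsSymmPolytope P)
    {ξ : E n} (hξ : ξ ∈ extremePoints ℝ P) : μHE[n - 1] (polarFacet P ξ) ≠ 0 := by
  have hξ0 := hP.extremePoint_ne_zero hn hξ
  have h := volume_coneOver hn hξ0 one_pos (hP.isClosed_polarFacet hn hξ)
    fun x hx => ((hP.mem_polarFacet_iff hn hξ).1 hx).2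
  intro hzero
  rw [hzero, mul_zero] at h
  obtain ⟨r, hr, -, w, hw⟩ := hP.exists_mem_innerFacet hn hξ
  set U : Set (E n) := {x | 0 < ⟪ξ, x⟫} ∩ {x | ⟪ξ, x⟫ < 1} ∩
    ⋂ η ∈ extremePoints ℝ P \ {ξ}, {x | ⟪η, x⟫ < ⟪ξ, x⟫} with hU
  have hUo : IsOpen U := by
    refine ((isOpen_lt (by fun_prop) (by fun_prop)).inter
      (isOpen_lt (by fun_prop) (by fun_prop))).inter ?_
    exact hP.finite_extremePoints.sdiff.isOpen_biInter fun η _ =>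
      isOpen_lt (by fun_prop) (by fun_prop)
  have hUne : U.Nonempty := by
    refine ⟨(1 / 2 : ℝ) • w, ⟨?_, ?_⟩, mem_iInter₂.2 fun η hη => ?_⟩
    · rw [mem_ofPred_eq, inner_smul_right, hw.1]; norm_num
    · rw [mem_ofPred_eq, inner_smul_right, hw.1]; norm_num
    · rw [mem_ofPred_eq, inner_smul_right, inner_smul_right, hw.1]
      have := hw.2 η hη.1 hη.2
      linarith
  have hUsub : U ⊆ coneOver ξ 1 (polarFacet P ξ) := by
    rintro x ⟨⟨h1, h2⟩, h3⟩
    rw [mem_ofPred_eq] at h1 h2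
    refine ⟨h1, h2, (hP.mem_polarFacet_iff hn hξ).2 ⟨hP.mem_polar_iff.2 fun η hη => ?_,
      inner_div_smul h1.ne'⟩⟩
    by_cases hηξ : η = ξ
    · rw [hηξ, inner_div_smul h1.ne']
    · have h4 : ⟪η, x⟫ < ⟪ξ, x⟫ := mem_iInter₂.1 h3 η ⟨hη, hηξ⟩
      rw [inner_smul_right, one_div, inv_mul_le_iff₀ h1, mul_one]
      exact h4.le
  exact (hUo.measure_pos volume hUne).ne' (measure_mono_null hUsub h)

theorem densityPolar_pos (hn : 1 ≤ n) (hP : IsSymmPolytope P) {ξ : E n}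
    (hξ : ξ ∈ extremePoints ℝ P) : 0 < densityPolar P ξ := by
  have h1 := ENNReal.toReal_pos (hP.euclideanHausdorffMeasure_polarFacet_ne_zero hn hξ)
    (hP.euclideanHausdorffMeasure_polarFacet_ne_top hn hξ)
  have h2 := norm_pos_iff.2 (hP.extremePoint_ne_zero hn hξ)
  have h3 := hP.volume_polar_toReal_pos
  have h4 : (0 : ℝ) < n := by exact_mod_cast hn
  unfold densityPolar
  positivity

theorem measurableSet_pyramid (hn : 1 ≤ n) (hP : IsSymmPolytope P) {ξ x : E n}
    (hξ : ξ ∈ extremePoints ℝ P) (hx : 1 < ⟪ξ, x⟫) :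
    MeasurableSet (pyramid (polarFacet P ξ) x) := by
  rw [pyramid_eq (fun y hy => ((hP.mem_polarFacet_iff hn hξ).1 hy).2) hx]
  refine (measurableSet_coneOver _ _ ?_).preimage (by fun_prop)
  exact (isometry_sub_left x).isClosedEmbedding.isClosedMap _ (hP.isClosed_polarFacet hn hξ)

/-- The apex is at distance `(⟪ξ, x⟫ - 1) / ‖ξ‖` from the base, which explains the factor `1 / ‖ξ‖`
in `densityPolar`. -/
theorem volume_pyramid (hn : 1 ≤ n) (hP : IsSymmPolytope P) {ξ x : E n}
    (hξ : ξ ∈ extremePoints ℝ P) (hx : 1 < ⟪ξ, x⟫) :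
    volume (pyramid (polarFacet P ξ) x) =
      ENNReal.ofReal ((⟪ξ, x⟫ - 1) * densityPolar P ξ) * volume (polar P) := by
  have hF : ∀ y ∈ polarFacet P ξ, ⟪ξ, y⟫ = 1 := fun y hy =>
    ((hP.mem_polarFacet_iff hn hξ).1 hy).2
  have hcl : IsClosed ((fun y => x - y) '' polarFacet P ξ) :=
    (isometry_sub_left x).isClosedEmbedding.isClosedMap _ (hP.isClosed_polarFacet hn hξ)
  have hξ1 := norm_pos_iff.2 (hP.extremePoint_ne_zero hn hξ)
  have hv := hP.volume_polar_toReal_pos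
  have hn0 : (0 : ℝ) < n := by exact_mod_cast hn
  have hh : 0 < ⟪ξ, x⟫ - 1 := by linarith
  rw [pyramid_eq hF hx, volume_preimage_sub_left _ (measurableSet_coneOver _ _ hcl),
    volume_coneOver hn (hP.extremePoint_ne_zero hn hξ) hh hcl ?_,
    (isometry_sub_left x).euclideanHausdorffMeasure_image,
    ← ENNReal.ofReal_toReal (hP.euclideanHausdorffMeasure_polarFacet_ne_top hn hξ),
    ← ENNReal.ofReal_toReal (hP.isCompact_polar.measure_lt_top).ne,
    ← ENNReal.ofReal_mul (by positivity), ← ENNReal.ofReal_mul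
      (mul_nonneg hh.le (hP.densityPolar_pos hn hξ).le)]
  · congr 1
    unfold densityPolar
    field_simp
  · rintro _ ⟨y, hy, rfl⟩
    rw [inner_sub_right, hF y hy]

/-- The illumination body is contained in the polar of the suitably shrunk vertices. -/
theorem inner_le_of_mem_illuminationBody (hn : 1 ≤ n) (hP : IsSymmPolytope P) {ξ x : E n}
    (hξ : ξ ∈ extremePoints ℝ P) {δ : ℝ} (hδ : 0 ≤ δ) (hx : x ∈ illuminationBody (polar P) δ) :
    ⟪ξ, x⟫ ≤ 1 + δ * (densityPolar P ξ)⁻¹ := by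
  have hd := hP.densityPolar_pos hn hξ
  rcases le_or_gt ⟪ξ, x⟫ 1 with h | h
  · have : 0 ≤ δ * (densityPolar P ξ)⁻¹ := by positivity
    linarith
  -- The pyramid lies strictly beyond the facet hyperplane, so its whole volume is added to that of
  -- the polar.
  have hdisj : Disjoint (polar P) (pyramid (polarFacet P ξ) x) := by
    rw [Set.disjoint_left]
    rintro _ hp ⟨y, hy, s, hs, rfl⟩
    have h1 := hp ξ hξ.1
    rw [inner_add_right, inner_smul_right, inner_smul_right,
      ((hP.mem_polarFacet_iff hn hξ).1 hy).2] at h1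
    nlinarith [hs.2]
  have hsub : polar P ∪ pyramid (polarFacet P ξ) x ⊆ convexHull ℝ (polar P ∪ {x}) := by
    refine union_subset (subset_union_left.trans (subset_convexHull ℝ _)) ?_
    rintro _ ⟨y, hy, s, hs, rfl⟩
    exact (convex_convexHull ℝ (polar P ∪ {x})) (subset_convexHull ℝ _ (mem_union_right _ rfl))
      (subset_convexHull ℝ _ (mem_union_left _ hy.1)) (sub_nonneg.2 hs.2.le) hs.1.le (by ring)
  have h1 := (measure_mono hsub).trans hx
  rw [measure_union hdisj (hP.measurableSet_pyramid hn hξ h), hP.volume_pyramid hn hξ h,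
    ENNReal.ofReal_add zero_le_one hδ, add_mul, ENNReal.ofReal_one, one_mul,
    ENNReal.add_le_add_iff_left hP.isCompact_polar.measure_lt_top.ne,
    ENNReal.mul_le_mul_iff_left hP.volume_polar_pos.ne' hP.isCompact_polar.measure_lt_top.ne,
    ENNReal.ofReal_le_ofReal_iff hδ, ← le_div_iff₀ hd, div_eq_mul_inv] at h1
  linarith

/-- A point from which only one facet is visible belongs to the illumination body if it is
sufficiently close to that facet. -/
theorem mem_illuminationBody (hn : 1 ≤ n) (hP : IsSymmPolytope P) {ξ x : E n}
    (hξ : ξ ∈ extremePoints ℝ P) {δ : ℝ} (hδ : 0 ≤ δ)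
    (hx : ⟪ξ, x⟫ ≤ 1 + δ * (densityPolar P ξ)⁻¹)
    (hx' : ∀ η ∈ extremePoints ℝ P, η ≠ ξ → ⟪η, x⟫ ≤ 1) : x ∈ illuminationBody (polar P) δ := by
  have hd := hP.densityPolar_pos hn hξ
  rw [illuminationBody, mem_ofPred_eq]
  rcases le_or_gt ⟪ξ, x⟫ 1 with h | h
  · have hxQ : x ∈ polar P := hP.mem_polar_iff.2 fun η hη => by
      by_cases hηξ : η = ξ
      · rwa [hηξ]
      · exact hx' η hη hηξ
    rw [union_eq_self_of_subset_right (singleton_subset_iff.2 hxQ), (convex_polar P).convexHull_eq]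
    refine le_mul_of_one_le_left zero_le ?_
    rw [ENNReal.one_le_ofReal]
    linarith
  have hsub : convexHull ℝ (polar P ∪ {x}) ⊆ polar P ∪ pyramid (polarFacet P ξ) x ∪ {x} := by
    rw [union_singleton, convexHull_insert ⟨0, zero_mem_polar P⟩, (convex_polar P).convexHull_eq]
    intro p hp
    obtain ⟨_, rfl, q, hq, a, b, ha, hb, hab, rfl⟩ := mem_convexJoin.1 hp
    rename_i x
    obtain rfl : a = 1 - b := by linarith
    have hother : ∀ η ∈ extremePoints ℝ P, η ≠ ξ → ∀ c : ℝ, 0 ≤ c → c ≤ 1 →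
        ⟪η, (1 - c) • x + c • q⟫ ≤ 1 := by
      intro η hη hηξ c hc hc1
      rw [inner_add_right, inner_smul_right, inner_smul_right]
      nlinarith [hx' η hη hηξ, hq η hη.1]
    have hmem : ∀ c : ℝ, 0 ≤ c → c ≤ 1 → ⟪ξ, (1 - c) • x + c • q⟫ ≤ 1 →
        (1 - c) • x + c • q ∈ polar P := by
      intro c hc hc1 hcξ
      refine hP.mem_polar_iff.2 fun η hη => ?_
      by_cases hηξ : η = ξ
      · rwa [hηξ]
      · exact hother η hη hηξ c hc hc1
    rcases le_or_gt ⟪ξ, (1 - b) • x + b • q⟫ 1 with h1 | h1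
    · exact Or.inl (Or.inl (hmem b hb (by linarith) h1))
    · rcases hb.eq_or_lt with rfl | hb0
      · right; simp
      · left; right
        have hqξ := hq ξ hξ.1
        set A := ⟪ξ, x⟫ with hA
        set B := ⟪ξ, q⟫ with hB
        rw [inner_add_right, inner_smul_right, inner_smul_right, ← hA, ← hB] at h1
        have hAB : 0 < A - B := by linarith
        -- The segment from `x` to `q` crosses the hyperplane of the facet at parameter `μ`; the
        -- crossing point satisfies the other constraints, hence lies in the facet.
        set μ := (A - 1) / (A - B) with hμ
        have hμ0 : 0 < μ := div_pos (by linarith) hAB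
        have hμ1 : μ ≤ 1 := by rw [hμ, div_le_one hAB]; linarith
        have hμe : μ * (A - B) = A - 1 := div_mul_cancel₀ _ hAB.ne'
        have hyξ : ⟪ξ, (1 - μ) • x + μ • q⟫ = 1 := by
          rw [inner_add_right, inner_smul_right, inner_smul_right, ← hA, ← hB]
          linarith
        have hbμ : b < μ := by
          rw [hμ, lt_div_iff₀ hAB]; linarith
        refine ⟨(1 - μ) • x + μ • q,
          (hP.mem_polarFacet_iff hn hξ).2 ⟨hmem μ hμ0.le hμ1 hyξ.le, hyξ⟩, b / μ,
          ⟨by positivity, by rwa [div_lt_one hμ0]⟩, ?_⟩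
        have : b = b / μ * μ := by field_simp
        nth_rewrite 1 2 [this]
        module
  have hsing : volume ({x} : Set (E n)) = 0 := by
    have : Nontrivial (E n) := by
      refine ⟨ξ, 0, hP.extremePoint_ne_zero hn hξ⟩
    exact measure_singleton x
  calc volume (convexHull ℝ (polar P ∪ {x}))
      ≤ volume (polar P ∪ pyramid (polarFacet P ξ) x ∪ {x}) := measure_mono hsub
    _ ≤ volume (polar P) + volume (pyramid (polarFacet P ξ) x) + volume {x} :=
        (measure_union_le _ _).trans (by gcongr; exact measure_union_le _ _)
    _ ≤ ENNReal.ofReal (1 + δ) * volume (polar P) := by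
        rw [hsing, add_zero, hP.volume_pyramid hn hξ h, ENNReal.ofReal_add zero_le_one hδ, add_mul,
          ENNReal.ofReal_one, one_mul]
        gcongr
        rw [← le_div_iff₀ hd, div_eq_mul_inv]
        linarith

end IsSymmPolytope

/-! ### Caps at a vertex and the Santaló point. -/

/-- The normalized volume of the cap that the functional `y` cuts off the tangent cone of `P` at
the vertex `ξ`. -/
def capVolume (P : Set (E n)) (ξ y : E n) : ENNReal :=
  ENNReal.ofReal (‖ξ‖ / n) * μHE[n - 1] (relPolar (polarFacet P ξ) y)

theorem isClosed_relPolar (F : Set (E n)) (y : E n) : IsClosed (relPolar F y) := by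
  have : relPolar F y = (vectorSpan ℝ F : Set (E n)) ∩ ⋂ x ∈ F, {w : E n | ⟪x - y, w⟫ ≤ 1} := by
    ext; simp [relPolar]
  rw [this]
  exact (Submodule.closed_of_finiteDimensional _).inter
    (isClosed_biInter fun x _ => isClosed_le (by fun_prop) (by fun_prop))

/-- The open cone of height one of which the caps of the tangent cone of `P` at a vertex are
reflected dilates. -/
def openCap (F : Set (E n)) (y : E n) : Set (E n) :=
  {z | 0 < ⟪y, z⟫ ∧ ⟪y, z⟫ < 1 ∧ ∀ y' ∈ F, 0 ≤ ⟪y', z⟫}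

theorem measurableSet_openCap (F : Set (E n)) (y : E n) : MeasurableSet (openCap F y) := by
  have : openCap F y = {z | 0 < ⟪y, z⟫} ∩ ({z | ⟪y, z⟫ < 1} ∩ ⋂ y' ∈ F, {z | 0 ≤ ⟪y', z⟫}) := by
    ext; simp [openCap]
  rw [this]
  exact (isOpen_lt (by fun_prop) (by fun_prop)).measurableSet.inter
    ((isOpen_lt (by fun_prop) (by fun_prop)).measurableSet.inter
      (isClosed_biInter fun x _ => isClosed_le (by fun_prop) (by fun_prop)).measurableSet)

namespace IsSymmPolytope

/-- A shear along `ξ` carries the level sets of `ξ` to those of `y`. It has determinant one because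
`y` and `ξ / ‖ξ‖²` take the same value at `ξ`, and it reduces the cap to a cone over a reflected
copy of `(F - y)°`. -/
theorem volume_openCap (hn : 1 ≤ n) (hP : IsSymmPolytope P) {ξ y : E n}
    (hξ : ξ ∈ extremePoints ℝ P) (hy : y ∈ polarFacet P ξ) :
    volume (openCap (polarFacet P ξ) y) = capVolume P ξ y := by
  have hξ0 := hP.extremePoint_ne_zero hn hξ
  have hξ1 : 0 < ‖ξ‖ := norm_pos_iff.2 hξ0
  have hn0 : (0 : ℝ) < n := by exact_mod_cast hn
  have hF : ∀ y ∈ polarFacet P ξ, ⟪y, ξ⟫ = 1 := fun y hy => by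
    rw [real_inner_comm]; exact ((hP.mem_polarFacet_iff hn hξ).1 hy).2
  set A : Set (E n) := (fun w => ξ - w) '' relPolar (polarFacet P ξ) y with hA
  have hAc : IsClosed A := (isometry_sub_left ξ).isClosedEmbedding.isClosedMap _
    (isClosed_relPolar _ _)
  have hAξ : ∀ x ∈ A, ⟪ξ, x⟫ = ‖ξ‖ ^ 2 := by
    rintro _ ⟨w, hw, rfl⟩
    rw [inner_sub_right, (hP.mem_vectorSpan_polarFacet hn hξ).1 hw.1, real_inner_self_eq_norm_sq,
      sub_zero]
  have hvol := volume_coneOver hn hξ0 (by positivity) hAc hAξ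
  rw [(isometry_sub_left ξ).euclideanHausdorffMeasure_image] at hvol
  set f : Module.Dual ℝ (E n) := (innerSL ℝ ((‖ξ‖ ^ 2)⁻¹ • ξ - y)).toLinearMap with hf
  have hfx : ∀ x, f x = (‖ξ‖ ^ 2)⁻¹ * ⟪ξ, x⟫ - ⟪y, x⟫ := by
    intro x
    rw [hf, ContinuousLinearMap.coe_coe, innerSL_apply_apply, inner_sub_left, real_inner_smul_left]
  have hdet : LinearMap.det (LinearMap.transvection f ξ) = 1 := by
    rw [LinearMap.transvection.det, hfx, real_inner_self_eq_norm_sq, hF y hy,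
      inv_mul_cancel₀ (by positivity)]
    ring
  have hpre : LinearMap.transvection f ξ ⁻¹' openCap (polarFacet P ξ) y =
      coneOver ξ (‖ξ‖ ^ 2) A := by
    ext x
    have hT : ∀ y' ∈ polarFacet P ξ, ⟪y', LinearMap.transvection f ξ x⟫ =
        ⟪y', x⟫ + ((‖ξ‖ ^ 2)⁻¹ * ⟪ξ, x⟫ - ⟪y, x⟫) := by
      intro y' hy'
      rw [LinearMap.transvection.apply, inner_add_right, inner_smul_right, hF y' hy', hfx, mul_one]
    set q := (‖ξ‖ ^ 2)⁻¹ * ⟪ξ, x⟫ with hq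
    have hyT : ⟪y, LinearMap.transvection f ξ x⟫ = q := by rw [hT y hy]; ring
    have hξx : ⟪ξ, x⟫ = ‖ξ‖ ^ 2 * q := by rw [hq]; field_simp
    have hξ2 : 0 < ‖ξ‖ ^ 2 := by positivity
    rw [mem_preimage, openCap, mem_ofPred_eq, coneOver, mem_ofPred_eq, hyT, hξx]
    have hA' : ∀ v, v ∈ A ↔ ξ - v ∈ relPolar (polarFacet P ξ) y := fun v =>
      ⟨by rintro ⟨w, hw, rfl⟩; simpa using hw, fun h => ⟨ξ - v, h, by simp⟩⟩
    have key : 0 < q → ((‖ξ‖ ^ 2 / (‖ξ‖ ^ 2 * q)) • x ∈ A ↔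
        ∀ y' ∈ polarFacet P ξ, 0 ≤ ⟪y', LinearMap.transvection f ξ x⟫) := by
      intro hq0
      have hqq : ‖ξ‖ ^ 2 / (‖ξ‖ ^ 2 * q) = q⁻¹ := by field_simp
      rw [hA', hqq, relPolar, mem_ofPred_eq, hP.mem_vectorSpan_polarFacet hn hξ, inner_sub_right,
        inner_smul_right, hξx, real_inner_self_eq_norm_sq, and_iff_right (by field_simp; ring)]
      refine forall₂_congr fun y' hy' => ?_
      rw [hT y' hy', inner_sub_left, inner_sub_right, inner_sub_right, inner_smul_right,
        inner_smul_right, hF y' hy', hF y hy]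
      have : 1 - q⁻¹ * ⟪y', x⟫ - (1 - q⁻¹ * ⟪y, x⟫) = q⁻¹ * (⟪y, x⟫ - ⟪y', x⟫) := by ring
      rw [this, inv_mul_le_iff₀ hq0]
      constructor <;> intro h <;> linarith
    constructor
    · rintro ⟨h1, h2, h3⟩
      exact ⟨mul_pos hξ2 h1, by nlinarith, (key h1).2 h3⟩
    · rintro ⟨h1, h2, h3⟩
      have h4 : 0 < q := pos_of_mul_pos_right h1 hξ2.le
      exact ⟨h4, by nlinarith, (key h4).1 h3⟩
  rw [← hpre, Measure.addHaar_preimage_linearMap _ (by rw [hdet]; exact one_ne_zero), hdet] at hvol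
  simp only [inv_one, abs_one, ENNReal.ofReal_one, one_mul] at hvol
  rw [hvol, capVolume]
  congr 2
  field_simp

/-- The volume of a cap of the tangent cone of `P` at the vertex `ξ`. -/
theorem volume_cone_cap (hn : 1 ≤ n) (hP : IsSymmPolytope P) {ξ y : E n}
    (hξ : ξ ∈ extremePoints ℝ P) (hy : y ∈ polarFacet P ξ) {s : ℝ} (hs : 0 < s) :
    volume (polar (polarFacet P ξ) ∩ {x | 1 - s ≤ ⟪y, x⟫}) =
      ENNReal.ofReal (s ^ n) * capVolume P ξ y := by
  have hF : ∀ y ∈ polarFacet P ξ, ⟪y, ξ⟫ = 1 := fun y hy => by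
    rw [real_inner_comm]; exact ((hP.mem_polarFacet_iff hn hξ).1 hy).2
  have hy0 : y ≠ 0 := by
    rintro rfl
    simpa using hF 0 hy
  set K := openCap (polarFacet P ξ) y with hK
  -- Up to two null hyperplanes the cap is the dilate `s • K`, reflected to have its apex at `ξ`.
  have hpre : volume ((fun x => ξ - x) ⁻¹' (s • K)) = ENNReal.ofReal (s ^ n) * capVolume P ξ y := by
    rw [volume_preimage_sub_left _ ((measurableSet_openCap _ _).const_smul₀ s),
      Measure.addHaar_smul, hP.volume_openCap hn hξ hy, finrank_euclideanSpace_fin,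
      abs_of_pos (pow_pos hs n)]
  have hmem : ∀ x, x ∈ (fun x => ξ - x) ⁻¹' (s • K) ↔
      1 - s < ⟪y, x⟫ ∧ ⟪y, x⟫ < 1 ∧ x ∈ polar (polarFacet P ξ) := by
    intro x
    rw [mem_preimage, mem_smul_set_iff_inv_smul_mem₀ hs.ne', hK, openCap, mem_ofPred_eq]
    have hin : ∀ y' ∈ polarFacet P ξ, ⟪y', s⁻¹ • (ξ - x)⟫ = s⁻¹ * (1 - ⟪y', x⟫) := by
      intro y' hy'
      rw [inner_smul_right, inner_sub_right, hF y' hy']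
    rw [hin y hy, and_left_comm]
    refine (and_congr ?_ (and_congr ?_ ?_))
    · rw [inv_mul_lt_iff₀ hs]; constructor <;> intro h <;> linarith
    · rw [mul_pos_iff_of_pos_left (inv_pos.2 hs), sub_pos]
    · refine forall₂_congr fun y' hy' => ?_
      rw [hin y' hy', mul_nonneg_iff_of_pos_left (inv_pos.2 hs), sub_nonneg]
  refine le_antisymm ?_ ?_
  · have hsub : polar (polarFacet P ξ) ∩ {x | 1 - s ≤ ⟪y, x⟫} ⊆
        (fun x => ξ - x) ⁻¹' (s • K) ∪ {x | ⟪y, x⟫ = 1 - s} ∪ {x | ⟪y, x⟫ = 1} := by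
      rintro x ⟨h1, h2⟩
      rw [mem_ofPred_eq] at h2
      rcases h2.eq_or_lt with h | h
      · exact Or.inl (Or.inr h.symm)
      · rcases (h1 y hy).eq_or_lt with h' | h'
        · exact Or.inr h'
        · exact Or.inl (Or.inl ((hmem x).2 ⟨h, h', h1⟩))
    refine (measure_mono hsub).trans ((measure_union_le _ _).trans ?_)
    rw [volume_hyperplane hy0, add_zero]
    refine (measure_union_le _ _).trans ?_
    rw [volume_hyperplane hy0, add_zero, hpre]
  · rw [← hpre]
    refine measure_mono fun x hx => ?_
    obtain ⟨h1, -, h3⟩ := (hmem x).1 hx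
    exact ⟨h3, h1.le⟩

/-- `P` is contained in its tangent cone `polar (polarFacet P ξ)`, so no margin for `y` and no
smallness of `s` is needed. -/
theorem volume_cap_le (hn : 1 ≤ n) (hP : IsSymmPolytope P) {ξ y : E n}
    (hξ : ξ ∈ extremePoints ℝ P) (hy : y ∈ polarFacet P ξ) {s : ℝ} (hs : 0 < s) :
    volume (P ∩ {x | 1 - s ≤ ⟪y, x⟫}) ≤ ENNReal.ofReal (s ^ n) * capVolume P ξ y := by
  rw [← hP.volume_cone_cap hn hξ hy hs]
  refine measure_mono (inter_subset_inter_left _ fun x hx y' hy' => ?_)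
  rw [real_inner_comm]
  exact hy'.1 x hx

/-- Near a vertex `P` agrees with its tangent cone. -/
theorem volume_cap_eq (hn : 1 ≤ n) (hP : IsSymmPolytope P) {ξ y : E n}
    (hξ : ξ ∈ extremePoints ℝ P) {r : ℝ} (hr : 0 < r) (hr1 : r ≤ 1) (hy : y ∈ innerFacet P ξ r)
    {s : ℝ} (hs : 0 < s) (hsr : s ≤ r) :
    volume (P ∩ {x | 1 - s ≤ ⟪y, x⟫}) = ENNReal.ofReal (s ^ n) * capVolume P ξ y := by
  have hyF := hP.innerFacet_subset_polarFacet hn hξ hr.le hy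
  refine le_antisymm (hP.volume_cap_le hn hξ hyF hs) ?_
  rw [← hP.volume_cone_cap hn hξ hyF hs]
  refine measure_mono fun x hx => ⟨?_, hx.2⟩
  obtain ⟨hx1, hx2⟩ := hx
  rw [mem_ofPred_eq] at hx2
  refine mem_of_forall_polar hP.convex hP.isClosed hP.zero_mem fun z hz => ?_
  set a := ⟪ξ, z⟫ with ha
  have ha1 : a ≤ 1 := hz ξ hξ.1
  have hD : r ≤ 1 - (1 - r) * a := by nlinarith
  have hD0 : 0 < 1 - (1 - r) * a := by linarith
  -- Chosen so that `(1 - ε * a) * (1 - r) + ε = 1`. This puts `(1 - ε * a) • y + ε • z` into the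
  -- facet, and the same identity turns the facet inequality at `x` into `⟪z, x⟫ ≤ 1`.
  set ε := r / (1 - (1 - r) * a) with hε
  have hε0 : 0 < ε := by positivity
  have hε1 : ε ≤ 1 := (div_le_one hD0).2 hD
  have hεD : ε * (1 - (1 - r) * a) = r := div_mul_cancel₀ _ hD0.ne'
  have hεa : 0 ≤ 1 - ε * a := by nlinarith
  have hyz : (1 - ε * a) • y + ε • z ∈ polarFacet P ξ := by
    rw [hP.mem_polarFacet_iff hn hξ, hP.mem_polar_iff]
    have h1 : ⟪ξ, (1 - ε * a) • y + ε • z⟫ = 1 := by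
      rw [inner_add_right, inner_smul_right, inner_smul_right, hy.1, ← ha]; ring
    refine ⟨fun η hη => ?_, h1⟩
    by_cases hηξ : η = ξ
    · rw [hηξ, h1]
    · rw [inner_add_right, inner_smul_right, inner_smul_right]
      have h2 := mul_le_mul_of_nonneg_left (hy.2 η hη hηξ) hεa
      have h3 := mul_le_mul_of_nonneg_left (hz η hη.1) hε0.le
      linarith
  have h4 := hx1 _ hyz
  rw [inner_add_left, real_inner_smul_left, real_inner_smul_left] at h4
  have h5 := mul_le_mul_of_nonneg_left (show 1 - r ≤ ⟪y, x⟫ by linarith) hεa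
  rw [real_inner_comm]
  have h6 : ε * ⟪z, x⟫ ≤ ε * 1 := by linarith
  exact le_of_mul_le_mul_left h6 hε0

theorem exists_pos_le_norm_sub (hn : 1 ≤ n) (hP : IsSymmPolytope P) :
    ∃ D > 0, ∀ ξ ∈ extremePoints ℝ P, ∀ η ∈ extremePoints ℝ P, η ≠ ξ → D ≤ ‖η - ξ‖ := by
  obtain ⟨ξ, hξ⟩ := hP.extremePoints_nonempty
  have hne := hP.neg_ne_extremePoint hn hξ
  obtain ⟨⟨a, b⟩, hab, hmin⟩ := Set.exists_min_image (extremePoints ℝ P).offDiag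
    (fun p => ‖p.1 - p.2‖) hP.finite_extremePoints.offDiag
    ⟨(-ξ, ξ), hP.neg_mem_extremePoints hξ, hξ, hne⟩
  exact ⟨‖a - b‖, norm_pos_iff.2 (sub_ne_zero.2 hab.2.2),
    fun ξ hξ η hη h => hmin (η, ξ) ⟨hη, hξ, h⟩⟩

/-- Caps whose normal is near the relative boundary of a facet of the polar are large. -/
theorem exists_le_volume_cap (hn : 1 ≤ n) (hP : IsSymmPolytope P) (M : ℝ) :
    ∃ r > 0, ∃ s₀ > 0, ∀ ξ ∈ extremePoints ℝ P, ∀ y ∈ polarFacet P ξ, y ∉ innerFacet P ξ r →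
      ∀ s, 0 < s → s ≤ s₀ → ENNReal.ofReal (M * s ^ n) ≤ volume (P ∩ {x | 1 - s ≤ ⟪y, x⟫}) := by
  obtain ⟨ρ, hρ, hball⟩ := hP.exists_ball_subset
  obtain ⟨D, hD, hDle⟩ := hP.exists_pos_le_norm_sub hn
  set κ := (volume (Metric.ball (0 : E n) 1)).toReal with hκ
  have hκtop : volume (Metric.ball (0 : E n) 1) ≠ ⊤ := measure_ball_lt_top.ne
  have hκ0 : 0 < κ := ENNReal.toReal_pos (Metric.measure_ball_pos _ _ one_pos).ne' hκtop
  obtain ⟨N, hN1, hN⟩ : ∃ N : ℕ, (1 : ℝ) ≤ N ∧ M ≤ N * ((ρ / 4) ^ n * κ) := by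
    obtain ⟨N, hN⟩ := exists_nat_ge (max 1 (M / ((ρ / 4) ^ n * κ)))
    exact ⟨N, (le_max_left _ _).trans hN,
      (div_le_iff₀ (by positivity)).1 ((le_max_right _ _).trans hN)⟩
  have hN0 : (0 : ℝ) < N := by linarith
  refine ⟨D / (2 * N * ρ), by positivity, min 1 (D / (N * ρ)), by positivity,
    fun ξ hξ y hy hyr s hs hs0 => ?_⟩
  obtain ⟨hyQ, hyξ⟩ := (hP.mem_polarFacet_iff hn hξ).1 hy
  obtain ⟨η, hη, hηξ, hlt⟩ : ∃ η ∈ extremePoints ℝ P, η ≠ ξ ∧ 1 - D / (2 * N * ρ) < ⟪η, y⟫ := by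
    by_contra! h
    exact hyr ⟨hyξ, h⟩
  have hs1 : s ≤ 1 := hs0.trans (min_le_left _ _)
  have hs2 : s * (N * ρ) ≤ D := (le_div_iff₀ (by positivity)).1 (hs0.trans (min_le_right _ _))
  have hDη := hDle ξ hξ η hη hηξ
  -- Consecutive points on the segment from `ξ` to `η` are at least `s * ρ` apart, enough room for
  -- balls of radius `s * ρ / 4`. Over all `N` points the height drops by at most `s / 2`, since `η`
  -- violates the margin `D / (2 * N * ρ)`.
  set l := s * ρ / D with hl
  have hl0 : 0 < l := by positivity
  have hlD : l * D = s * ρ := div_mul_cancel₀ _ hD.ne'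
  have hlN : N * l ≤ 1 := by
    rw [hl, ← mul_div_assoc, div_le_one hD]; linarith
  have hil : ∀ i < N, (i : ℝ) * l ≤ N * l := fun i hi =>
    mul_le_mul_of_nonneg_right (by exact_mod_cast hi.le) hl0.le
  have hcap := card_mul_le_volume_cap hP.convex hρ hball (u := y) (p := ξ) (k := l • (η - ξ))
    (t := 1 - s) (τ := s / 2) (by positivity) (by linarith) N (fun i hi => ?_) ?_ (fun i hi => ?_)
  · refine le_trans ?_ hcap
    rw [← ENNReal.ofReal_toReal hκtop, ← ENNReal.ofReal_mul (by positivity)]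
    refine ENNReal.ofReal_le_ofReal ?_
    rw [← hκ, show s / 2 * (ρ / 2) = (ρ / 4) * s by ring, mul_pow]
    have := mul_le_mul_of_nonneg_right hN (pow_nonneg hs.le n)
    linarith
  · have h1 := hP.convex hξ.1 hη.1 (a := 1 - i * l) (b := i * l)
      (by have := hil i hi; linarith) (by positivity) (by ring)
    convert h1 using 1
    module
  · rw [norm_smul, Real.norm_of_nonneg hl0.le]
    have : l * D ≤ l * ‖η - ξ‖ := mul_le_mul_of_nonneg_left hDη hl0.le
    have h3 : 0 ≤ l * ‖η - ξ‖ := by positivity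
    nlinarith
  · have h1 : ⟪y, ξ + (i : ℝ) • l • (η - ξ)⟫ = 1 - (i * l) * (1 - ⟪η, y⟫) := by
      rw [inner_add_right, inner_smul_right, inner_smul_right, inner_sub_right,
        real_inner_comm ξ y, hyξ, real_inner_comm η y]
      ring
    have h2 : (i * l) * (1 - ⟪η, y⟫) ≤ s / 2 := calc
      (i * l) * (1 - ⟪η, y⟫) ≤ (N * l) * (D / (2 * N * ρ)) :=
        mul_le_mul (hil i hi) (by linarith) (by linarith [hyQ η hη.1]) (by positivity)
      _ = (l * D) / (2 * ρ) := by field_simp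
      _ = s / 2 := by rw [hlD]; field_simp
    rw [h1]
    nlinarith

end IsSymmPolytope

theorem innerFacet_anti (P : Set (E n)) (ξ : E n) {r r' : ℝ} (h : r ≤ r') :
    innerFacet P ξ r' ⊆ innerFacet P ξ r :=
  fun _ hy => ⟨hy.1, fun η hη hηξ => (hy.2 η hη hηξ).trans (by linarith)⟩

/-- The volume of a cap depends continuously on its normal. -/
theorem continuousAt_volume_cap {K : Set (E n)} (hK : IsCompact K) {y : E n} (hy : y ≠ 0) (t : ℝ) :
    ContinuousAt (fun y => volume (K ∩ {x | t ≤ ⟪y, x⟫})) y := by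
  refine tendsto_measure_of_ae_tendsto_indicator (𝓝 y)
    (hK.measurableSet.inter (measurableSet_halfSpace y t))
    (fun i => hK.measurableSet.inter (measurableSet_halfSpace i t)) hK.measurableSet
    hK.measure_lt_top.ne (Eventually.of_forall fun i => inter_subset_left) ?_
  -- Membership in the half-space is locally constant in the normal except at points of the bounding
  -- hyperplane.
  have hae : ∀ᵐ x ∂(volume : Measure (E n)), ⟪y, x⟫ ≠ t :=
    measure_eq_zero_iff_ae_notMem.1 (volume_hyperplane hy t)
  filter_upwards [hae] with x hx
  have hc : Tendsto (fun z : E n => ⟪z, x⟫) (𝓝 y) (𝓝 ⟪y, x⟫) :=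
    (by fun_prop : Continuous fun z : E n => ⟪z, x⟫).tendsto y
  rcases hx.lt_or_gt with h | h
  · filter_upwards [hc.eventually (gt_mem_nhds h)] with z hz
    simp only [mem_inter_iff, mem_ofPred_eq, not_le.2 hz, not_le.2 h]
  · filter_upwards [hc.eventually (lt_mem_nhds h)] with z hz
    simp only [mem_inter_iff, mem_ofPred_eq, hz.le, h.le]

namespace IsSymmPolytope

theorem isCompact_innerFacet (hP : IsSymmPolytope P) (ξ : E n) {r : ℝ} (hr : 0 ≤ r) :
    IsCompact (innerFacet P ξ r) := by
  refine hP.isCompact_polar.of_isClosed_subset ?_ (hP.innerFacet_subset_polar hr)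
  have : innerFacet P ξ r = {y | ⟪ξ, y⟫ = 1} ∩
      ⋂ η ∈ extremePoints ℝ P \ {ξ}, {y : E n | ⟪η, y⟫ ≤ 1 - r} := by
    ext; simp [innerFacet]
  rw [this]
  exact (isClosed_eq (by fun_prop) (by fun_prop)).inter
    (isClosed_biInter fun η _ => isClosed_le (by fun_prop) (by fun_prop))

theorem capVolume_ne_top (hn : 1 ≤ n) (hP : IsSymmPolytope P) {ξ y : E n}
    (hξ : ξ ∈ extremePoints ℝ P) {r : ℝ} (hr : 0 < r) (hr1 : r ≤ 1) (hy : y ∈ innerFacet P ξ r) :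
    capVolume P ξ y ≠ ⊤ := by
  intro h
  have h1 := hP.volume_cap_eq hn hξ hr hr1 hy hr le_rfl
  rw [h, ENNReal.mul_top (ENNReal.ofReal_pos.2 (pow_pos hr n)).ne'] at h1
  exact ((measure_mono inter_subset_left).trans_lt hP.isCompact.measure_lt_top).ne h1

theorem capVolume_ne_zero (hn : 1 ≤ n) (hP : IsSymmPolytope P) {ξ y : E n}
    (hξ : ξ ∈ extremePoints ℝ P) {r : ℝ} (hr : 0 < r) (hr1 : r ≤ 1) (hy : y ∈ innerFacet P ξ r) :
    capVolume P ξ y ≠ 0 := by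
  intro h
  have h1 := hP.volume_cap_eq hn hξ hr hr1 hy hr le_rfl
  rw [h, mul_zero] at h1
  obtain ⟨ρ, hρ, hball⟩ := hP.exists_ball_subset
  obtain ⟨k, hk⟩ := exists_norm_eq hn hρ.le
  have h2 := card_mul_le_volume_cap hP.convex hρ hball (u := y) (p := ξ) (k := k) (t := 1 - r)
    (τ := r / 2) (by positivity) (by linarith) 1 (by simpa using hξ.1) (by rw [hk]; nlinarith)
    (fun i hi => by
      obtain rfl : i = 0 := by omega
      have : ⟪y, ξ⟫ = 1 := by rw [real_inner_comm]; exact hy.1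
      rw [Nat.cast_zero, zero_smul, add_zero, this]
      linarith)
  rw [h1, Nat.cast_one, one_mul] at h2
  refine absurd h2 (not_le.2 (ENNReal.mul_pos (ENNReal.ofReal_pos.2 (by positivity)).ne'
    (Metric.measure_ball_pos _ _ one_pos).ne'))

/-- The infimum of the volumes of the caps of the tangent cone at a vertex is attained. -/
theorem exists_min_capVolume (hn : 1 ≤ n) (hP : IsSymmPolytope P) {ξ : E n}
    (hξ : ξ ∈ extremePoints ℝ P) : ∃ r, 0 < r ∧ r ≤ 1 ∧ ∃ y₀ ∈ innerFacet P ξ r,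
      ∀ y ∈ polarFacet P ξ, capVolume P ξ y₀ ≤ capVolume P ξ y := by
  obtain ⟨r₁, hr₁, hr₁1, w, hw⟩ := hP.exists_mem_innerFacet hn hξ
  have hwtop := hP.capVolume_ne_top hn hξ hr₁ hr₁1 hw
  set M := (capVolume P ξ w).toReal with hM
  obtain ⟨r₂, hr₂, s₀, hs₀, hbig⟩ := hP.exists_le_volume_cap hn M
  set r := min r₁ r₂ with hr
  have hr0 : 0 < r := lt_min hr₁ hr₂
  have hr1 : r ≤ 1 := (min_le_left _ _).trans hr₁1
  set s := min s₀ r with hs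
  have hs0 : 0 < s := lt_min hs₀ hr0
  have hsr : s ≤ r := min_le_right _ _
  have hsn : ENNReal.ofReal (s ^ n) ≠ 0 := (ENNReal.ofReal_pos.2 (pow_pos hs0 n)).ne'
  have hwr : w ∈ innerFacet P ξ r := innerFacet_anti P ξ (min_le_left _ _) hw
  -- Caps of `P` of one fixed height `s` are minimized over a compact set of normals; by the choice
  -- of `M`, normals outside it cannot beat `w`.
  obtain ⟨y₀, hy₀, hmin⟩ := (hP.isCompact_innerFacet ξ hr0.le).exists_isMinOn ⟨w, hwr⟩
    (f := fun y => volume (P ∩ {x | 1 - s ≤ ⟪y, x⟫})) fun y hy =>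
      (continuousAt_volume_cap hP.isCompact (by rintro rfl; simpa using hy.1)
        (1 - s)).continuousWithinAt
  have hmin' : ∀ y ∈ innerFacet P ξ r, capVolume P ξ y₀ ≤ capVolume P ξ y := by
    intro y hy
    have h := hmin hy
    simp only [mem_ofPred_eq] at h
    rwa [hP.volume_cap_eq hn hξ hr0 hr1 hy₀ hs0 hsr, hP.volume_cap_eq hn hξ hr0 hr1 hy hs0 hsr,
      ENNReal.mul_le_mul_iff_right hsn ENNReal.ofReal_ne_top] at h
  refine ⟨r, hr0, hr1, y₀, hy₀, fun y hy => ?_⟩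
  by_cases hyr : y ∈ innerFacet P ξ r
  · exact hmin' y hyr
  · refine (hmin' w hwr).trans ?_
    have h1 := hbig ξ hξ y hy (fun h => hyr (innerFacet_anti P ξ (min_le_right _ _) h)) s hs0
      (min_le_left _ _)
    have h2 := h1.trans (hP.volume_cap_le hn hξ hy hs0)
    rwa [mul_comm, ENNReal.ofReal_mul (pow_pos hs0 n).le,
      ENNReal.mul_le_mul_iff_right hsn ENNReal.ofReal_ne_top, hM, ENNReal.ofReal_toReal hwtop] at h2

/-- The normalized volume of the caps in direction of the Santaló point is minimal. -/
theorem capVolume_santaloPoint (hn : 1 ≤ n) (hP : IsSymmPolytope P) {ξ y₀ : E n}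
    (hξ : ξ ∈ extremePoints ℝ P) {r : ℝ} (hr : 0 < r) (hy₀ : y₀ ∈ innerFacet P ξ r)
    (hmin : ∀ y ∈ polarFacet P ξ, capVolume P ξ y₀ ≤ capVolume P ξ y) :
    capVolume P ξ (santaloPoint (n - 1) (polarFacet P ξ)) = capVolume P ξ y₀ := by
  have hc : ENNReal.ofReal (‖ξ‖ / n) ≠ 0 := by
    have := norm_pos_iff.2 (hP.extremePoint_ne_zero hn hξ)
    have : (0 : ℝ) < n := by exact_mod_cast hn
    exact (ENNReal.ofReal_pos.2 (by positivity)).ne'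
  have hint := hP.innerFacet_subset_intrinsicInterior hn hξ hr hy₀
  have hsant : IsSantaloPoint (n - 1) (polarFacet P ξ) y₀ := by
    refine ⟨hint, fun t ht => ?_⟩
    have := hmin t (intrinsicInterior_subset ht)
    rwa [capVolume, capVolume, ENNReal.mul_le_mul_iff_right hc ENNReal.ofReal_ne_top] at this
  -- Existence suffices: all minimizers give the same volume, so the point picked by
  -- `Classical.epsilon` is immaterial.
  have hspec : IsSantaloPoint (n - 1) (polarFacet P ξ) (santaloPoint (n - 1) (polarFacet P ξ)) :=
    Classical.epsilon_spec (p := IsSantaloPoint (n - 1) (polarFacet P ξ)) ⟨y₀, hsant⟩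
  refine le_antisymm ?_ (hmin _ (intrinsicInterior_subset hspec.1))
  exact mul_le_mul_right (hspec.2 y₀ hint) _

/-- Finiteness matters because `density` is defined through `toReal`, which sends `⊤` to `0`. -/
theorem capVolume_santaloPoint_eq (hn : 1 ≤ n) (hP : IsSymmPolytope P) {ξ : E n}
    (hfin : capVolume P ξ (santaloPoint (n - 1) (polarFacet P ξ)) ≠ ⊤) :
    capVolume P ξ (santaloPoint (n - 1) (polarFacet P ξ)) =
      ENNReal.ofReal (density P ξ) * volume P := by
  have hn0 : (0 : ℝ) < n := by exact_mod_cast hn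
  have hv := hP.volume_toReal_pos
  rw [← ENNReal.ofReal_toReal hP.isCompact.measure_lt_top.ne, ← ENNReal.ofReal_mul' hv.le,
    ← ENNReal.ofReal_toReal hfin]
  congr 1
  rw [capVolume, ENNReal.toReal_mul, ENNReal.toReal_ofReal (by positivity), density]
  field_simp

/-- The caps at a vertex `ξ` have volume at least `s ^ n * density P ξ * |P|`, and the bound is
attained. -/
theorem density_spec (hn : 1 ≤ n) (hP : IsSymmPolytope P) {ξ : E n}
    (hξ : ξ ∈ extremePoints ℝ P) : 0 < density P ξ ∧
      (∀ r, 0 < r → r ≤ 1 → ∀ y ∈ innerFacet P ξ r, ∀ s, 0 < s → s ≤ r →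
        ENNReal.ofReal (s ^ n * density P ξ) * volume P ≤ volume (P ∩ {x | 1 - s ≤ ⟪y, x⟫})) ∧
      ∃ r, 0 < r ∧ r ≤ 1 ∧ ∃ y ∈ innerFacet P ξ r, ∀ s, 0 < s → s ≤ r →
        volume (P ∩ {x | 1 - s ≤ ⟪y, x⟫}) = ENNReal.ofReal (s ^ n * density P ξ) * volume P := by
  obtain ⟨r₀, hr₀, hr₀1, y₀, hy₀, hmin⟩ := hP.exists_min_capVolume hn hξ
  have heq := hP.capVolume_santaloPoint hn hξ hr₀ hy₀ hmin
  have htop := hP.capVolume_ne_top hn hξ hr₀ hr₀1 hy₀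
  have hden := hP.capVolume_santaloPoint_eq hn (heq ▸ htop)
  rw [heq] at hden
  have hmul : ∀ s : ℝ, 0 < s → ENNReal.ofReal (s ^ n) * capVolume P ξ y₀ =
      ENNReal.ofReal (s ^ n * density P ξ) * volume P := fun s hs => by
    rw [hden, ENNReal.ofReal_mul (pow_pos hs n).le, mul_assoc]
  refine ⟨?_, fun r hr hr1 y hy s hs hsr => ?_, r₀, hr₀, hr₀1, y₀, hy₀, fun s hs hsr => ?_⟩
  · by_contra! h
    rw [ENNReal.ofReal_of_nonpos h, zero_mul] at hden
    exact hP.capVolume_ne_zero hn hξ hr₀ hr₀1 hy₀ hden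
  · rw [hP.volume_cap_eq hn hξ hr hr1 hy hs hsr, ← hmul s hs]
    exact mul_le_mul_right (hmin y (hP.innerFacet_subset_polarFacet hn hξ hr.le hy)) _
  · rw [hP.volume_cap_eq hn hξ hr₀ hr₀1 hy₀ hs hsr, hmul s hs]

end IsSymmPolytope

/-! ### Rates at the vertices and the function `Gc`. -/

/-- The rate at which the floating body recedes from the vertex `ξ`. -/
def floatRate (P : Set (E n)) (ξ : E n) : ℝ :=
  (density P ξ ^ (1 / n : ℝ))⁻¹

/-- The rate at which the polar of the illumination body recedes from the vertex `ξ`. -/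
def illumRate (P : Set (E n)) (ξ : E n) : ℝ :=
  (densityPolar P ξ)⁻¹

namespace IsSymmPolytope

theorem floatRate_pos (hn : 1 ≤ n) (hP : IsSymmPolytope P) {ξ : E n}
    (hξ : ξ ∈ extremePoints ℝ P) : 0 < floatRate P ξ :=
  inv_pos.2 (Real.rpow_pos_of_pos (hP.density_spec hn hξ).1 _)

theorem floatRate_pow_mul (hn : 1 ≤ n) (hP : IsSymmPolytope P) {ξ : E n}
    (hξ : ξ ∈ extremePoints ℝ P) : floatRate P ξ ^ n * density P ξ = 1 := by
  have hd := (hP.density_spec hn hξ).1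
  rw [floatRate, inv_pow, one_div, Real.rpow_inv_natCast_pow hd.le (by omega),
    inv_mul_cancel₀ hd.ne']

theorem illumRate_pos (hn : 1 ≤ n) (hP : IsSymmPolytope P) {ξ : E n}
    (hξ : ξ ∈ extremePoints ℝ P) : 0 < illumRate P ξ :=
  inv_pos.2 (hP.densityPolar_pos hn hξ)

theorem exists_illumRate_le (hP : IsSymmPolytope P) :
    ∃ B > 0, ∀ ξ ∈ extremePoints ℝ P, illumRate P ξ ≤ B := by
  obtain ⟨ξ, hξ, h⟩ := Set.exists_max_image _ (illumRate P) hP.finite_extremePoints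
    hP.extremePoints_nonempty
  exact ⟨max 1 (illumRate P ξ), by positivity, fun η hη => (h η hη).trans (le_max_right _ _)⟩

/-- The first quotient simplifies to a difference of rates, and `c` over the minimal density is the
largest of the numbers `c * illumRate P ξ`. In this form the two constraints of the comparison are
visible. -/
theorem Gc_le_iff (hn : 1 ≤ n) (hP : IsSymmPolytope P) {c g : ℝ} (hc : 0 ≤ c) :
    Gc P c ≤ g ↔ ∀ ξ ∈ extremePoints ℝ P,
      floatRate P ξ - c * illumRate P ξ ≤ g ∧ c * illumRate P ξ ≤ g := by
  have : Finite (extremePoints ℝ P) := hP.finite_extremePoints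
  have : Nonempty (extremePoints ℝ P) := hP.extremePoints_nonempty.to_subtype
  have hbdd : BddBelow (range fun η : extremePoints ℝ P => densityPolar P η) :=
    (Set.finite_range _).bddBelow
  have hmle : ∀ η : extremePoints ℝ P, ⨅ η : extremePoints ℝ P, densityPolar P η ≤
    densityPolar P η := fun η => ciInf_le hbdd η
  obtain ⟨η₀, hη₀⟩ := exists_eq_ciInf_of_finite (f := fun η : extremePoints ℝ P => densityPolar P η)
  have hm : 0 < ⨅ η : extremePoints ℝ P, densityPolar P η := by
    rw [← hη₀]; exact hP.densityPolar_pos hn η₀.2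
  have hfirst : ∀ ξ ∈ extremePoints ℝ P,
      (densityPolar P ξ - c * density P ξ ^ (1 / n : ℝ)) /
        (density P ξ ^ (1 / n : ℝ) * densityPolar P ξ) = floatRate P ξ - c * illumRate P ξ := by
    intro ξ hξ
    have h1 := (hP.densityPolar_pos hn hξ).ne'
    have h2 := (Real.rpow_pos_of_pos (hP.density_spec hn hξ).1 (1 / n : ℝ)).ne'
    rw [floatRate, illumRate]
    field_simp
  rw [Gc, ciSup_le_iff (Set.finite_range _).bddAbove]
  simp only [max_le_iff]
  constructor
  · intro h ξ hξ
    obtain ⟨h1, h2⟩ := h ⟨ξ, hξ⟩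
    rw [hfirst ξ hξ] at h1
    refine ⟨h1, le_trans ?_ h2⟩
    rw [illumRate, ← div_eq_mul_inv]
    exact div_le_div_of_nonneg_left hc hm (hmle ⟨ξ, hξ⟩)
  · rintro h ⟨ξ, hξ⟩
    refine ⟨by rw [hfirst ξ hξ]; exact (h ξ hξ).1, ?_⟩
    rw [← hη₀, div_eq_mul_inv]
    exact (h η₀ η₀.2).2

theorem Gc_nonneg (hn : 1 ≤ n) (hP : IsSymmPolytope P) {c : ℝ} (hc : 0 ≤ c) : 0 ≤ Gc P c := by
  obtain ⟨ξ, hξ⟩ := hP.extremePoints_nonempty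
  have := ((hP.Gc_le_iff hn hc).1 le_rfl ξ hξ).2
  have := hP.illumRate_pos hn hξ
  exact le_trans (by positivity) ‹c * illumRate P ξ ≤ Gc P c›

theorem exists_Gc_le_add (hn : 1 ≤ n) (hP : IsSymmPolytope P) : ∃ B > 0, ∀ c ≥ 0, ∀ c' ≥ 0,
    Gc P c' ≤ Gc P c + B * |c' - c| := by
  obtain ⟨B, hB, hle⟩ := hP.exists_illumRate_le
  refine ⟨B, hB, fun c hc c' hc' => (hP.Gc_le_iff hn hc').2 fun ξ hξ => ?_⟩
  obtain ⟨h1, h2⟩ := (hP.Gc_le_iff hn hc).1 le_rfl ξ hξ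
  have h3 : |(c' - c) * illumRate P ξ| ≤ B * |c' - c| := by
    rw [abs_mul, abs_of_pos (hP.illumRate_pos hn hξ), mul_comm]
    exact mul_le_mul_of_nonneg_right (hle ξ hξ) (abs_nonneg _)
  obtain ⟨h4, h5⟩ := abs_le.1 h3
  constructor <;> linarith

/-- `Gc P` is Lipschitz and grows at least linearly, so it suffices to minimize over a compact
interval. -/
theorem exists_isLeast_Gc (hn : 1 ≤ n) (hP : IsSymmPolytope P) :
    ∃ c ≥ 0, ∀ c' ≥ 0, Gc P c ≤ Gc P c' := by
  obtain ⟨B, hB, hlip⟩ := hP.exists_Gc_le_add hn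
  obtain ⟨ξ, hξ⟩ := hP.extremePoints_nonempty
  have hβ := hP.illumRate_pos hn hξ
  have hcont : ContinuousOn (Gc P) (Ici 0) := by
    refine (LipschitzOnWith.of_dist_le_mul (K := B.toNNReal) fun x hx y hy => ?_).continuousOn
    rw [Real.dist_eq, Real.dist_eq, Real.coe_toNNReal _ hB.le, abs_le]
    have h1 := hlip x hx y hy
    have h2 := hlip y hy x hx
    rw [abs_sub_comm] at h1
    constructor <;> linarith
  have hG0 := hP.Gc_nonneg hn le_rfl
  set C := Gc P 0 / illumRate P ξ with hC
  have hC0 : 0 ≤ C := by positivity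
  obtain ⟨c, hc, hmin⟩ := (isCompact_Icc (a := (0 : ℝ)) (b := C)).exists_isMinOn ⟨0, le_rfl, hC0⟩
    (hcont.mono Icc_subset_Ici_self)
  refine ⟨c, hc.1, fun c' hc' => ?_⟩
  rcases le_or_gt c' C with h | h
  · exact hmin ⟨hc', h⟩
  · have h1 : Gc P c ≤ Gc P 0 := hmin ⟨le_rfl, hC0⟩
    have h2 := ((hP.Gc_le_iff hn hc').1 le_rfl ξ hξ).2
    rw [hC, div_lt_iff₀ hβ] at h
    linarith

theorem isLeast_G (hn : 1 ≤ n) (hP : IsSymmPolytope P) : IsLeast (Gc P '' Ici 0) (G P) := by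
  obtain ⟨c, hc, hmin⟩ := hP.exists_isLeast_Gc hn
  have h : IsLeast (Gc P '' Ici 0) (Gc P c) :=
    ⟨⟨c, hc, rfl⟩, by rintro _ ⟨c', hc', rfl⟩; exact hmin c' hc'⟩
  rw [G, h.csInf_eq]
  exact h

/-- The parameter `δ' = c * θ` has to be positive, whereas the minimizing `c` is only known to be
nonnegative. -/
theorem exists_pos_Gc_le (hn : 1 ≤ n) (hP : IsSymmPolytope P) {ε : ℝ} (hε : 0 < ε) :
    ∃ c > 0, Gc P c ≤ G P + ε := by
  obtain ⟨c, hc, hcG⟩ := (hP.isLeast_G hn).1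
  rw [mem_Ici] at hc
  obtain ⟨B, hB, hlip⟩ := hP.exists_Gc_le_add hn
  have hεB : 0 < ε / B := by positivity
  refine ⟨c + ε / B, by positivity, ?_⟩
  have h := hlip c hc (c + ε / B) (by positivity)
  rw [add_sub_cancel_left, abs_of_pos hεB, mul_div_cancel₀ _ hB.ne', hcG] at h
  exact h

theorem G_nonneg (hn : 1 ≤ n) (hP : IsSymmPolytope P) : 0 ≤ G P := by
  obtain ⟨c, hc, hcG⟩ := (hP.isLeast_G hn).1
  rw [← hcG]
  exact hP.Gc_nonneg hn hc

/-! ### Inclusions between the bodies -/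

theorem polar_subset_illuminationBody (hn : 1 ≤ n) (hP : IsSymmPolytope P) {δ : ℝ} (hδ : 0 ≤ δ) :
    polar P ⊆ illuminationBody (polar P) δ := by
  intro y hy
  obtain ⟨ξ, hξ⟩ := hP.extremePoints_nonempty
  have := hP.illumRate_pos hn hξ
  refine hP.mem_illuminationBody hn hξ hδ ?_ fun η hη _ => hy η hη.1
  have h1 := hy ξ hξ.1
  have h2 : 0 ≤ δ * (densityPolar P ξ)⁻¹ := mul_nonneg hδ this.le
  linarith

theorem polarIllumination_subset (hn : 1 ≤ n) (hP : IsSymmPolytope P) {δ : ℝ} (hδ : 0 ≤ δ) :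
    polarIllumination P δ ⊆ P := fun x hx =>
  mem_of_forall_polar hP.convex hP.isClosed hP.zero_mem fun y hy => by
    rw [real_inner_comm]
    exact hx y (hP.polar_subset_illuminationBody hn hδ hy)

theorem smul_mem_polarIllumination (hn : 1 ≤ n) (hP : IsSymmPolytope P) {δ : ℝ} (hδ : 0 ≤ δ)
    {ξ : E n} (hξ : ξ ∈ extremePoints ℝ P) :
    (1 + δ * illumRate P ξ)⁻¹ • ξ ∈ polarIllumination P δ := by
  intro y hy
  have h := hP.inner_le_of_mem_illuminationBody hn hξ hδ hy
  have h0 : 0 < 1 + δ * illumRate P ξ := by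
    have := mul_nonneg hδ (hP.illumRate_pos hn hξ).le
    linarith
  rw [inner_smul_right, inv_mul_le_iff₀ h0, mul_one, real_inner_comm]
  exact h

theorem smul_mem_polarIllumination_of_le (hn : 1 ≤ n) (hP : IsSymmPolytope P) {δ : ℝ} (hδ : 0 ≤ δ)
    {a : ℝ} (ha0 : 0 < a) (ha : ∀ ξ ∈ extremePoints ℝ P, 1 + δ * illumRate P ξ ≤ a) {x : E n}
    (hx : x ∈ P) : (1 / a) • x ∈ polarIllumination P δ := by
  intro y hy
  obtain ⟨ξ, hξ, hmax⟩ := hP.exists_extremePoint_max y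
  have h := hP.inner_le_of_mem_illuminationBody hn hξ hδ hy
  rw [inner_smul_right, one_div, inv_mul_le_iff₀ ha0, mul_one, real_inner_comm]
  exact (hmax x hx).trans (h.trans (ha ξ hξ))

theorem floatingBody_subset (hP : IsSymmPolytope P) (δ : ℝ) : floatingBody P δ ⊆ P := by
  intro x hx
  refine mem_of_forall_polar hP.convex hP.isClosed hP.zero_mem fun y hy => ?_
  rw [real_inner_comm]
  by_cases hy0 : y = 0
  · simp [hy0]
  -- For `t > 1` the cap is empty, so it is admissible whatever the value of `δ`.
  refine le_of_forall_gt_imp_ge_of_dense fun t ht => hx y t hy0 ?_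
  have : P ∩ {z | t ≤ ⟪y, z⟫} = ∅ := by
    ext z
    simp only [mem_inter_iff, mem_ofPred_eq, mem_empty_iff_false, iff_false, not_and, not_le]
    intro hz
    rw [real_inner_comm]
    exact (hy z hz).trans_lt ht
  rw [this, measure_empty]
  exact bot_le

/-- A half-space that cuts off `(1 / 2) • v` contains a ball in `P` of a fixed radius. This crude
bound only serves to show that the distance is an infimum over a nonempty set. -/
theorem exists_half_smul_mem_floatingBody (hn : 1 ≤ n) (hP : IsSymmPolytope P) :
    ∃ δ₀ > 0, ∀ δ ≤ δ₀, ∀ v ∈ P, (1 / 2 : ℝ) • v ∈ floatingBody P δ := by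
  obtain ⟨ρ, hρ, hball⟩ := hP.exists_ball_subset
  obtain ⟨k, hk⟩ := exists_norm_eq hn hρ.le
  set κ := (volume (Metric.ball (0 : E n) 1)).toReal with hκ
  have hκtop : volume (Metric.ball (0 : E n) 1) ≠ ⊤ := measure_ball_lt_top.ne
  have hκ0 : 0 < κ := ENNReal.toReal_pos (Metric.measure_ball_pos _ _ one_pos).ne' hκtop
  have hv := hP.volume_toReal_pos
  set m := (1 / 2 * (ρ / 2)) ^ n * κ with hm
  have hm0 : 0 < m := by positivity
  refine ⟨m / (2 * (volume P).toReal), by positivity, fun δ hδ v hvP u t _ hcap => ?_⟩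
  by_contra! hlt
  rw [inner_smul_right] at hlt
  have h := card_mul_le_volume_cap hP.convex hρ hball (u := u) (p := v) (k := k) (t := t)
    (τ := 1 / 2) (by norm_num) (by norm_num) 1 (by simpa using hvP) (by rw [hk]; linarith)
    (fun i hi => by
      obtain rfl : i = 0 := by omega
      rw [Nat.cast_zero, zero_smul, add_zero]
      linarith)
  have h2 := h.trans hcap
  rw [← ENNReal.ofReal_toReal hκtop, ← ENNReal.ofReal_toReal hP.isCompact.measure_lt_top.ne,
    ← ENNReal.ofReal_mul (by positivity), ← ENNReal.ofReal_mul' hv.le, Nat.cast_one, one_mul,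
    ← hκ, ← hm] at h2
  have h3 : δ * (volume P).toReal ≤ m / 2 := by
    calc δ * (volume P).toReal ≤ m / (2 * (volume P).toReal) * (volume P).toReal :=
          mul_le_mul_of_nonneg_right hδ hv.le
      _ = m / 2 := by field_simp
  have h4 := h2.trans (ENNReal.ofReal_le_ofReal h3)
  rw [ENNReal.ofReal_le_ofReal_iff (by positivity)] at h4
  linarith

/-- Away from its vertices `P` is approximated by its floating body to higher order. -/
theorem eventually_smul_mem_floatingBody (hP : IsSymmPolytope P) {p q : E n} (hp : p ∈ P)
    (hq : q ∈ P) (hpq : q ≠ p) {l : ℝ} (hl0 : 0 < l) (hl1 : l < 1) {ε : ℝ} (hε : 0 < ε) :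
    ∀ᶠ θ in 𝓝[>] (0 : ℝ), (1 - ε * θ) • ((1 - l) • p + l • q) ∈ floatingBody P (θ ^ n) := by
  obtain ⟨ρ, hρ, hball⟩ := hP.exists_ball_subset
  set κ := (volume (Metric.ball (0 : E n) 1)).toReal with hκ
  have hκtop : volume (Metric.ball (0 : E n) 1) ≠ ⊤ := measure_ball_lt_top.ne
  have hκ0 : 0 < κ := ENNReal.toReal_pos (Metric.measure_ball_pos _ _ one_pos).ne' hκtop
  have hv := hP.volume_toReal_pos
  -- `N` balls of radius `ε * θ * ρ / 2` have total volume more than `θ ^ n * |P|`; since `N` does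
  -- not depend on `θ`, the row fits along the segment once `θ` is small.
  obtain ⟨N, hN⟩ := exists_nat_gt ((volume P).toReal / ((ε * (ρ / 2)) ^ n * κ))
  rw [div_lt_iff₀ (by positivity)] at hN
  have hD : 0 < ‖q - p‖ := norm_pos_iff.2 (sub_ne_zero.2 hpq)
  set D := ‖q - p‖ with hDdef
  set m := min l (1 - l) with hm
  have hm0 : 0 < m := lt_min hl0 (by linarith)
  have hev : ∀ᶠ θ in 𝓝[>] (0 : ℝ), ε * θ < 1 / 2 ∧ N * (2 * (ε * θ) * ρ / D) < m := by
    have h1 : Tendsto (fun θ : ℝ => ε * θ) (𝓝[>] 0) (𝓝 0) :=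
      ((by fun_prop : Continuous fun θ : ℝ => ε * θ).tendsto' 0 0 (by simp)).mono_left
        nhdsWithin_le_nhds
    have h2 : Tendsto (fun θ : ℝ => N * (2 * (ε * θ) * ρ / D)) (𝓝[>] 0) (𝓝 0) :=
      ((by fun_prop : Continuous fun θ : ℝ => N * (2 * (ε * θ) * ρ / D)).tendsto' 0 0
        (by simp)).mono_left nhdsWithin_le_nhds
    exact (h1.eventually (gt_mem_nhds (by norm_num))).and (h2.eventually (gt_mem_nhds hm0))
  filter_upwards [hev, self_mem_nhdsWithin] with θ ⟨hθ1, hθ2⟩ hθ0 u t _ hcap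
  rw [mem_Ioi] at hθ0
  by_contra! hlt
  rw [inner_smul_right] at hlt
  set w := 2 * (ε * θ) * ρ / D with hw
  have hw0 : 0 < w := by positivity
  have hwD : w * D = 2 * (ε * θ) * ρ := div_mul_cancel₀ _ hD.ne'
  -- The row runs in the direction of the segment along which `u` does not decrease, so all balls
  -- stay in the cap.
  obtain ⟨σ, hσ, hσu⟩ : ∃ σ : ℝ, |σ| = 1 ∧ 0 ≤ σ * ⟪u, q - p⟫ := by
    rcases le_total 0 ⟪u, q - p⟫ with h | h
    · exact ⟨1, by simp, by simpa using h⟩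
    · exact ⟨-1, by simp, by linarith⟩
  have h := card_mul_le_volume_cap hP.convex hρ hball (u := u) (p := (1 - l) • p + l • q)
    (k := (σ * w) • (q - p)) (t := t) (τ := ε * θ) (by positivity) (by linarith) N
    (fun i hi => ?_) ?_ (fun i hi => ?_)
  · have h2 := h.trans hcap
    rw [← ENNReal.ofReal_toReal hκtop, ← ENNReal.ofReal_toReal hP.isCompact.measure_lt_top.ne,
      ← ENNReal.ofReal_mul (by positivity), ← ENNReal.ofReal_mul' hv.le,
      ENNReal.ofReal_le_ofReal_iff (by positivity), ← hκ,
      show ε * θ * (ρ / 2) = θ * (ε * (ρ / 2)) by ring, mul_pow] at h2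
    have h3 := mul_lt_mul_of_pos_left hN (pow_pos hθ0 n)
    linarith
  · have hiw : (i : ℝ) * w ≤ m := by
      have : (i : ℝ) * w ≤ N * w := mul_le_mul_of_nonneg_right (by exact_mod_cast hi.le) hw0.le
      linarith
    have hab : |i * (σ * w)| ≤ m := by
      rw [abs_mul, abs_mul, hσ, one_mul, abs_of_pos hw0, Nat.abs_cast]; exact hiw
    obtain ⟨h1, h2⟩ := abs_le.1 hab
    have h3 := min_le_left l (1 - l)
    have h4 := min_le_right l (1 - l)
    have h5 := hP.convex hp hq (a := 1 - (l + i * (σ * w))) (b := l + i * (σ * w)) (by linarith)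
      (by linarith) (by ring)
    convert h5 using 1
    module
  · rw [norm_smul, Real.norm_eq_abs, abs_mul, hσ, one_mul, abs_of_pos hw0, ← hDdef, hwD]
    have : 0 < ε * θ * ρ := by positivity
    nlinarith
  · rw [inner_add_right, inner_smul_right, inner_smul_right]
    have h1 : 0 ≤ (i : ℝ) * (σ * w * ⟪u, q - p⟫) := by
      have : σ * w * ⟪u, q - p⟫ = w * (σ * ⟪u, q - p⟫) := by ring
      rw [this]
      positivity
    nlinarith

end IsSymmPolytope

/-! ### The upper bound for the distance. -/

theorem bodyDist_le {S₁ S₂ : Set (E n)} {a : ℝ} (ha : 1 ≤ a) (h₁ : (1 / a) • S₁ ⊆ S₂)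
    (h₂ : S₂ ⊆ a • S₁) : bodyDist S₁ S₂ ≤ a :=
  csInf_le ⟨1, fun _ h => h.1⟩ ⟨ha, h₁, h₂⟩

theorem floatIllumDist_le (K : Set (E n)) (δ : ℝ) {δ' : ℝ} (hδ' : 0 < δ') :
    floatIllumDist K δ ≤ bodyDist (floatingBody K δ) (polarIllumination K δ') :=
  ciInf_le (f := fun δ' : Ioi (0 : ℝ) => bodyDist (floatingBody K δ) (polarIllumination K δ'))
    ⟨0, by rintro _ ⟨x, rfl⟩; exact Real.sInf_nonneg fun a ha => zero_le_one.trans ha.1⟩ ⟨δ', hδ'⟩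

theorem eventually_nhdsGT_zero {p : ℝ → Prop} {b : ℝ} (hb : 0 < b)
    (h : ∀ θ, 0 < θ → θ < b → p θ) : ∀ᶠ θ in 𝓝[>] (0 : ℝ), p θ := by
  filter_upwards [Ioo_mem_nhdsGT hb] with θ hθ
  exact h θ hθ.1 hθ.2

/-- The expansion behind the comparison of the two bodies at a vertex. -/
theorem eventually_one_le_mul {α b k : ℝ} (h : α < b + k) :
    ∀ᶠ θ in 𝓝[>] (0 : ℝ), 1 ≤ (1 + θ * b) * ((1 + θ * k) * (1 - θ * α)) := by
  -- This function is the product minus one, divided by `θ`.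
  have h1 : Tendsto (fun θ : ℝ => (b + k - α) + θ * (b * k - b * α - k * α - θ * (b * k * α)))
      (𝓝[>] 0) (𝓝 (b + k - α)) :=
    ((by fun_prop : Continuous fun θ : ℝ =>
      (b + k - α) + θ * (b * k - b * α - k * α - θ * (b * k * α))).tendsto' 0 _
        (by simp)).mono_left nhdsWithin_le_nhds
  filter_upwards [h1.eventually (lt_mem_nhds (by linarith : 0 < b + k - α)),
    self_mem_nhdsWithin] with θ hθ hθ0
  have h2 := mul_pos (show 0 < θ from hθ0) hθ
  nlinarith

namespace IsSymmPolytope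

/-- The polar of the illumination body is contained in a dilate of the floating body. -/
theorem eventually_polarIllumination_subset (hn : 1 ≤ n) (hP : IsSymmPolytope P) {c ε : ℝ}
    (hc : 0 < c) (hε : 0 < ε) : ∀ᶠ θ in 𝓝[>] (0 : ℝ),
      polarIllumination P (c * θ) ⊆ (1 + θ * (Gc P c + ε)) • floatingBody P (θ ^ n) := by
  have hv := hP.volume_toReal_pos
  have hvtop : volume P ≠ ⊤ := hP.isCompact.measure_lt_top.ne
  have hg := hP.Gc_nonneg hn hc.le
  set g := Gc P c with hgdef
  -- With this `M`, a cap of height `ε / 2 * θ` whose normal is near the facet boundary exceeds `θ ^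
  -- n * |P|`.
  set M := ((volume P).toReal + 1) / (ε / 2) ^ n with hM
  obtain ⟨r₀, hr₀, s₀, hs₀, hbig⟩ := hP.exists_le_volume_cap hn M
  set r := min r₀ 1 with hr
  have hr0 : 0 < r := lt_min hr₀ one_pos
  have hr1 : r ≤ 1 := min_le_right _ _
  have hev1 : ∀ᶠ θ in 𝓝[>] (0 : ℝ), θ * ε < 1 ∧ ε / 2 * θ < s₀ := by
    refine eventually_nhdsGT_zero (b := min (1 / ε) (s₀ / (ε / 2))) (by positivity)
      fun θ hθ hlt => ⟨?_, ?_⟩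
    · exact (lt_div_iff₀ hε).1 (hlt.trans_le (min_le_left _ _))
    · have := (lt_div_iff₀ (by positivity)).1 (hlt.trans_le (min_le_right _ _))
      linarith
  have hev2 : ∀ᶠ θ in 𝓝[>] (0 : ℝ), ∀ ξ ∈ extremePoints ℝ P, θ * floatRate P ξ < r ∧
      θ * (c * illumRate P ξ) < r ∧ 1 ≤ (1 + θ * (c * illumRate P ξ)) *
        ((1 + θ * (g + ε)) * (1 - θ * floatRate P ξ)) := by
    refine (Filter.eventually_all_finite hP.finite_extremePoints).2 fun ξ hξ => ?_
    have hα := hP.floatRate_pos hn hξ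
    have hβ := mul_pos hc (hP.illumRate_pos hn hξ)
    have h1 := ((hP.Gc_le_iff hn hc.le).1 hgdef.ge ξ hξ).1
    have h2 : ∀ᶠ θ in 𝓝[>] (0 : ℝ), θ * floatRate P ξ < r ∧ θ * (c * illumRate P ξ) < r :=
      eventually_nhdsGT_zero (b := min (r / floatRate P ξ) (r / (c * illumRate P ξ)))
        (by positivity) fun θ hθ hlt =>
        ⟨(lt_div_iff₀ hα).1 (hlt.trans_le (min_le_left _ _)),
          (lt_div_iff₀ hβ).1 (hlt.trans_le (min_le_right _ _))⟩
    filter_upwards [h2, eventually_one_le_mul (α := floatRate P ξ) (b := c * illumRate P ξ)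
      (k := g + ε) (by linarith)] with θ h3 h4
    exact ⟨h3.1, h3.2, h4⟩
  filter_upwards [hev1, hev2, self_mem_nhdsWithin] with θ ⟨hθε, hθs⟩ hθξ hθ0
  rw [mem_Ioi] at hθ0
  have hδ : 0 ≤ c * θ := by positivity
  set a := 1 + θ * (g + ε) with ha
  have ha0 : 0 < a := by positivity
  -- The inclusion, tested on half-spaces whose normal is scaled into a facet of the polar. For
  -- inner normals both rates enter; for the others the height `s` is negligible and `⟪y, x⟫ ≤ 1`
  -- suffices.
  have key : ∀ x ∈ polarIllumination P (c * θ), ∀ ξ ∈ extremePoints ℝ P, ∀ y ∈ polarFacet P ξ,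
      ∀ s, volume (P ∩ {z | 1 - s ≤ ⟪y, z⟫}) ≤ ENNReal.ofReal (θ ^ n) * volume P →
      ⟪y, x⟫ ≤ a * (1 - s) := by
    intro x hx ξ hξ y hy s hs
    obtain ⟨hsmall1, hsmall2, hprod⟩ := hθξ ξ hξ
    have hα := hP.floatRate_pos hn hξ
    have hβ := mul_pos hc (hP.illumRate_pos hn hξ)
    have hmono : ∀ s', s' ≤ s → volume (P ∩ {z | 1 - s' ≤ ⟪y, z⟫}) ≤
        ENNReal.ofReal (θ ^ n) * volume P := fun s' hs' =>
      (measure_mono (inter_subset_inter_right _ fun z hz => by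
        simp only [mem_ofPred_eq] at hz ⊢; linarith)).trans hs
    by_cases hyr : y ∈ innerFacet P ξ r
    · have hsα : s ≤ θ * floatRate P ξ := by
        by_contra! hlt
        -- The volume bound holds only up to height `r`, so the cap is first lowered to height `min
        -- s r`.
        have h1 : θ * floatRate P ξ < min s r := lt_min hlt hsmall1
        have h0 : 0 < θ * floatRate P ξ := by positivity
        have h2 := ((hP.density_spec hn hξ).2.1 r hr0 hr1 y hyr (min s r) (h0.trans h1)
          (min_le_right _ _)).trans (hmono _ (min_le_left _ _))
        rw [ENNReal.mul_le_mul_iff_left hP.volume_pos.ne' hvtop,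
          ENNReal.ofReal_le_ofReal_iff (by positivity)] at h2
        have h3 : (θ * floatRate P ξ) ^ n < (min s r) ^ n := pow_lt_pow_left₀ h1 h0.le (by omega)
        have h4 := mul_lt_mul_of_pos_right h3 (hP.density_spec hn hξ).1
        rw [mul_pow, mul_assoc, hP.floatRate_pow_mul hn hξ, mul_one] at h4
        linarith
      have hβ0 : 0 < 1 + θ * (c * illumRate P ξ) := by positivity
      -- Since `θ * (c * illumRate P ξ) < r`, the margin `r` keeps the stretched point within all
      -- other constraints: it sees only the facet of `ξ`.
      have hmem : (1 + θ * (c * illumRate P ξ)) • y ∈ illuminationBody (polar P) (c * θ) := by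
        refine hP.mem_illuminationBody hn hξ hδ ?_ fun η hη hηξ => ?_
        · rw [inner_smul_right, hyr.1]
          exact le_of_eq (by rw [illumRate]; ring)
        · rw [inner_smul_right]
          have h5 := mul_le_mul_of_nonneg_left (hyr.2 η hη hηξ) hβ0.le
          nlinarith
      have h6 := hx _ hmem
      rw [real_inner_smul_left] at h6
      have h7 : (1 + θ * (c * illumRate P ξ)) * ⟪y, x⟫ ≤ (1 + θ * (c * illumRate P ξ)) *
          (a * (1 - θ * floatRate P ξ)) := h6.trans hprod
      have h8 := le_of_mul_le_mul_left h7 hβ0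
      have h9 := mul_le_mul_of_nonneg_left (show 1 - θ * floatRate P ξ ≤ 1 - s by linarith) ha0.le
      linarith
    · have hyr₀ : y ∉ innerFacet P ξ r₀ := fun h => hyr (innerFacet_anti P ξ (min_le_left _ _) h)
      have hs2 : s ≤ ε / 2 * θ := by
        by_contra! hlt
        have h2 := (hbig ξ hξ y hy hyr₀ (ε / 2 * θ) (by positivity) hθs.le).trans (hmono _ hlt.le)
        rw [← ENNReal.ofReal_toReal hvtop, ← ENNReal.ofReal_mul (by positivity),
          ENNReal.ofReal_le_ofReal_iff (by positivity), mul_pow, ← mul_assoc, hM,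
          div_mul_cancel₀ _ (by positivity)] at h2
        have := pow_pos hθ0 n
        nlinarith
      have h3 : ⟪y, x⟫ ≤ 1 := hx y (hP.polar_subset_illuminationBody hn hδ hy.1)
      have h4 : 1 + θ * ε ≤ a := by rw [ha]; nlinarith
      have h5 : 1 - ε / 2 * θ ≤ 1 - s := by linarith
      have h6 : (1 + θ * ε) * (1 - ε / 2 * θ) ≤ a * (1 - s) :=
        mul_le_mul h4 h5 (by linarith) ha0.le
      have h7 : 1 ≤ (1 + θ * ε) * (1 - ε / 2 * θ) := by
        have h8 : 0 ≤ (θ * ε) * (1 - θ * ε) := mul_nonneg (by positivity) (by linarith)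
        nlinarith
      linarith
  intro x hx
  rw [mem_smul_set_iff_inv_smul_mem₀ ha0.ne']
  intro u t hu hcap
  obtain ⟨ξ, hξ, hmax⟩ := hP.exists_extremePoint_max u
  obtain ⟨ζ, hζ, hζpos⟩ := hP.exists_inner_pos hu
  have hh : 0 < ⟪ξ, u⟫ := hζpos.trans_le (hmax ζ hζ.1)
  set h := ⟪ξ, u⟫ with hhdef
  have hy : h⁻¹ • u ∈ polarFacet P ξ := by
    rw [hP.mem_polarFacet_iff hn hξ]
    refine ⟨fun z hz => ?_, ?_⟩
    · rw [inner_smul_right, inv_mul_le_iff₀ hh, mul_one]; exact hmax z hz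
    · rw [inner_smul_right, ← hhdef, inv_mul_cancel₀ hh.ne']
  have hset : {z : E n | 1 - (1 - h⁻¹ * t) ≤ ⟪h⁻¹ • u, z⟫} = {z | t ≤ ⟪u, z⟫} := by
    ext z
    rw [mem_ofPred_eq, mem_ofPred_eq, real_inner_smul_left, sub_sub_cancel,
      mul_le_mul_iff_right₀ (inv_pos.2 hh)]
  have h1 := key x hx ξ hξ _ hy (1 - h⁻¹ * t) (by rw [hset]; exact hcap)
  rw [sub_sub_cancel, real_inner_smul_left, ← mul_assoc, mul_comm a, mul_assoc,
    mul_le_mul_iff_right₀ (inv_pos.2 hh)] at h1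
  rw [inner_smul_right, inv_mul_le_iff₀ ha0]
  exact h1

theorem eventually_floatIllumDist_le (hn : 1 ≤ n) (hP : IsSymmPolytope P) {ε : ℝ} (hε : 0 < ε) :
    ∀ᶠ θ in 𝓝[>] (0 : ℝ), floatIllumDist P (θ ^ n) ≤ 1 + θ * (G P + ε) := by
  obtain ⟨c, hc, hcG⟩ := hP.exists_pos_Gc_le hn (half_pos hε)
  have hg := hP.Gc_nonneg hn hc.le
  filter_upwards [hP.eventually_polarIllumination_subset hn hc (half_pos hε),
    self_mem_nhdsWithin] with θ hsub hθ0
  rw [mem_Ioi] at hθ0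
  have ha1 : 1 ≤ 1 + θ * (Gc P c + ε / 2) := by
    have : 0 ≤ θ * (Gc P c + ε / 2) := by positivity
    linarith
  refine (floatIllumDist_le P (θ ^ n) (mul_pos hc hθ0)).trans
    ((bodyDist_le ha1 ?_ hsub).trans ?_)
  · rintro _ ⟨x, hx, rfl⟩
    refine hP.smul_mem_polarIllumination_of_le hn (by positivity) (by linarith) (fun ξ hξ => ?_)
      (hP.floatingBody_subset _ hx)
    have := ((hP.Gc_le_iff hn hc.le).1 le_rfl ξ hξ).2
    nlinarith
  · have : θ * (Gc P c + ε / 2) ≤ θ * (G P + ε) :=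
      mul_le_mul_of_nonneg_left (by linarith) hθ0.le
    linarith

end IsSymmPolytope

/-! ### The lower bound for the distance. -/

/-- Nonemptiness is essential: `sInf ∅ = 0` in `ℝ`. -/
theorem le_bodyDist {S₁ S₂ : Set (E n)} {b : ℝ}
    (hne : ∃ a : ℝ, 1 ≤ a ∧ (1 / a) • S₁ ⊆ S₂ ∧ S₂ ⊆ a • S₁)
    (h : ∀ a : ℝ, 1 ≤ a → (1 / a) • S₁ ⊆ S₂ → S₂ ⊆ a • S₁ → b ≤ a) : b ≤ bodyDist S₁ S₂ :=
  le_csInf hne fun a ha => h a ha.1 ha.2.1 ha.2.2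

namespace IsSymmPolytope

/-- Near a vertex the illumination body allows displacements in the direction of that vertex. -/
theorem exists_mem_illuminationBody_adjacent (hn : 2 ≤ n) (hP : IsSymmPolytope P) {ξ : E n}
    (hξ : ξ ∈ extremePoints ℝ P) : ∃ η ∈ extremePoints ℝ P, η ≠ ξ ∧ ∃ C > 0, ∃ d₀ > 0,
      ∀ δ d, 0 < d → d ≤ d₀ → d ≤ δ → ∃ x ∈ illuminationBody (polar P) δ,
        ⟪x, ξ⟫ = 1 + d * illumRate P ξ ∧ 1 - d * C ≤ ⟪x, η⟫ := by
  have hn1 : 1 ≤ n := by omega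
  obtain ⟨η, hη, hηξ, w₀, hw₀, hξw₀, hηw₀⟩ := hP.exists_adjacent hn hξ
  obtain ⟨r, hr, hr1, w, hw⟩ := hP.exists_mem_innerFacet hn1 hξ
  have hβ := hP.illumRate_pos hn1 hξ
  set β := illumRate P ξ with hβdef
  -- In `x = (1 - d * k) • w₀ + (d * (k + β)) • w` the weights sum to `1 + d * β`, the required
  -- height over `ξ`. The choice `r * k = β` makes the margin of `w` pay for this excess at all
  -- other vertices.
  set k := β / r with hk
  have hk0 : 0 < k := by positivity
  have hkr : r * k = β := mul_div_cancel₀ _ hr.ne'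
  refine ⟨η, hη, hηξ, 2 * k + β, by positivity, 1 / k, by positivity, fun δ d hd hdd hdδ => ?_⟩
  have hdk : d * k ≤ 1 := (le_div_iff₀ hk0).1 hdd
  have hin : ∀ z : E n, ⟪z, (1 - d * k) • w₀ + (d * (k + β)) • w⟫ =
      (1 - d * k) * ⟪z, w₀⟫ + d * (k + β) * ⟪z, w⟫ := fun z => by
    rw [inner_add_right, inner_smul_right, inner_smul_right]
  have hxξ : ⟪ξ, (1 - d * k) • w₀ + (d * (k + β)) • w⟫ = 1 + d * β := by
    rw [hin, hξw₀, hw.1]; ring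
  have hdkβ : 0 ≤ d * (k + β) := by positivity
  refine ⟨(1 - d * k) • w₀ + (d * (k + β)) • w,
    hP.mem_illuminationBody hn1 hξ (hd.le.trans hdδ) ?_ fun ζ hζ hζξ => ?_, ?_, ?_⟩
  · rw [hxξ]
    have := mul_le_mul_of_nonneg_right hdδ hβ.le
    linarith [show δ * β = δ * (densityPolar P ξ)⁻¹ from rfl]
  · rw [hin]
    have h1 := mul_le_mul_of_nonneg_left (hw₀ ζ hζ.1) (sub_nonneg.2 hdk)
    have h2 := mul_le_mul_of_nonneg_left (hw.2 ζ hζ hζξ) hdkβ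
    have h3 : d * (k + β) * (1 - r) = d * k - d * β * r + d * (β - r * k) := by ring
    rw [h3, hkr] at h2
    have h4 : 0 ≤ d * β * r := by positivity
    linarith
  · rw [real_inner_comm, hxξ]
  · rw [real_inner_comm, hin, hηw₀]
    have h1 := mul_le_mul_of_nonneg_left
      (hP.inner_polar_ge hη.1 (hP.innerFacet_subset_polar hr.le hw)) hdkβ
    linarith

/-- Test the inclusion on a point near `ξ` of the segment to an adjacent vertex: the floating body
almost reaches it, while the illumination body has a point whose pairing with it is nearly `1 + δ' *
illumRate P ξ`. -/
theorem eventually_mul_illumRate_le (hn : 2 ≤ n) (hP : IsSymmPolytope P) {ξ : E n}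
    (hξ : ξ ∈ extremePoints ℝ P) {K ε : ℝ} (hK : 0 ≤ K) (hε : 0 < ε) :
    ∀ᶠ θ in 𝓝[>] (0 : ℝ), ∀ δ' > 0, ∀ a : ℝ, 1 ≤ a → a ≤ 1 + θ * K →
      (1 / a) • floatingBody P (θ ^ n) ⊆ polarIllumination P δ' →
      δ' * illumRate P ξ ≤ (a - 1) + ε * θ := by
  have hβ := hP.illumRate_pos (by omega) hξ
  obtain ⟨η, hη, hηξ, C, hC, d₀, hd₀, hx⟩ := hP.exists_mem_illuminationBody_adjacent hn hξ
  set β := illumRate P ξ with hβdef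
  set K₂ := 4 * (K + 1) with hK₂
  have hK₂0 : 0 < K₂ := by positivity
  set ε₁ := min 1 (ε / 2) with hε₁
  have hε₁0 : 0 < ε₁ := by positivity
  set ε₃ := min (1 / 2) (ε / (4 * K₂)) with hε₃
  have hε₃0 : 0 < ε₃ := by positivity
  have hε₃K : K₂ * ε₃ ≤ ε / 4 := by
    have := (le_div_iff₀ (by positivity)).1 (min_le_right (1 / 2) (ε / (4 * K₂)))
    linarith
  have hε₃h : ε₃ ≤ 1 / 2 := min_le_left _ _
  -- Moving by `l` towards `η` costs at most the fraction `ε₃` of the gain `d * β`.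
  set l := ε₃ * β / (β + C) with hl
  have hl0 : 0 < l := by positivity
  have hlC : l * (β + C) = ε₃ * β := div_mul_cancel₀ _ (by positivity)
  have hl1 : l < 1 := by rw [hl, div_lt_one (by positivity)]; nlinarith
  have hev : ∀ᶠ θ in 𝓝[>] (0 : ℝ), ε₁ * θ < 1 / 2 ∧ K₂ * ε₁ * θ < ε / 4 ∧ K₂ * θ < d₀ * β := by
    refine eventually_nhdsGT_zero
      (b := min (1 / 2 / ε₁) (min (ε / 4 / (K₂ * ε₁)) (d₀ * β / K₂))) (by positivity)
      fun θ hθ hlt => ⟨?_, ?_, ?_⟩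
    · have := (lt_div_iff₀ hε₁0).1 (hlt.trans_le (min_le_left _ _))
      linarith
    · have := (lt_div_iff₀ (by positivity)).1
        (hlt.trans_le ((min_le_right _ _).trans (min_le_left _ _)))
      linarith
    · have := (lt_div_iff₀ hK₂0).1
        (hlt.trans_le ((min_le_right _ _).trans (min_le_right _ _)))
      linarith
  filter_upwards [hev, hP.eventually_smul_mem_floatingBody hξ.1 hη.1 hηξ hl0 hl1 hε₁0,
    self_mem_nhdsWithin] with θ ⟨hθ1, hθ2, hθ3⟩ hmem hθ0 δ' hδ' a ha haK hsub
  rw [mem_Ioi] at hθ0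
  have hε₁1 : ε₁ * θ ≤ θ := by nlinarith [min_le_left 1 (ε / 2)]
  have hε₁2 : ε₁ * θ ≤ ε / 2 * θ := mul_le_mul_of_nonneg_right (min_le_right _ _) hθ0.le
  set d := min δ' d₀ with hd
  have hd0 : 0 < d := lt_min hδ' hd₀
  obtain ⟨x, hxI, hxξ, hxη⟩ := hx δ' d hd0 (min_le_right _ _) (min_le_left _ _)
  have h1 := hsub (smul_mem_smul_set hmem) x hxI
  rw [inner_smul_right, inner_smul_right, one_div, inv_mul_le_iff₀ (by linarith), mul_one,
    inner_add_right, inner_smul_right, inner_smul_right, hxξ] at h1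
  set D := d * β with hD
  have hD0 : 0 < D := by positivity
  have h2 : 1 + D - ε₃ * D ≤ (1 - l) * (1 + D) + l * ⟪x, η⟫ := by
    have h3 := mul_le_mul_of_nonneg_left hxη hl0.le
    have h4 : ε₃ * D = l * D + l * (d * C) := by rw [hD]; linear_combination -d * hlC
    linarith
  have hτ : 0 ≤ 1 - ε₁ * θ := by linarith
  have h3 := (mul_le_mul_of_nonneg_left h2 hτ).trans h1
  have hDsmall : D ≤ K₂ * θ := by
    have h5 : D / 4 ≤ (1 - ε₁ * θ) * ((1 - ε₃) * D) := by
      have : 1 / 2 * (1 / 2 * D) ≤ (1 - ε₁ * θ) * ((1 - ε₃) * D) :=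
        mul_le_mul (by linarith) (mul_le_mul_of_nonneg_right (by linarith) hD0.le)
          (by positivity) hτ
      linarith
    rw [hK₂]
    linarith
  -- Truncation at `d₀` is not active: the a priori bound `d * β ≤ K₂ * θ < d₀ * β` excludes `d =
  -- d₀`.
  have hdd : d = δ' := by
    rcases min_choice δ' d₀ with h | h
    · exact h
    · rw [hD, hd, h] at hDsmall
      linarith
  have h6 : 0 ≤ (ε₁ * θ) * (ε₃ * D) := by positivity
  have h7 : D * (ε₁ * θ) ≤ ε / 4 * θ := by
    have := mul_le_mul_of_nonneg_right hDsmall (show 0 ≤ ε₁ * θ by positivity)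
    nlinarith
  have h8 : ε₃ * D ≤ ε / 4 * θ := by
    have := mul_le_mul_of_nonneg_left hDsmall hε₃0.le
    nlinarith
  rw [← hdd, ← hD]
  linarith

/-- The shrunk vertex lies in the polar illumination body, and a volume-minimizing cap at `ξ`, of
relative volume exactly `θ ^ n`, cuts the floating body at height `1 - θ * floatRate P ξ`. -/
theorem eventually_one_le_of_polarIllumination_subset (hn : 1 ≤ n) (hP : IsSymmPolytope P)
    {ξ : E n} (hξ : ξ ∈ extremePoints ℝ P) : ∀ᶠ θ in 𝓝[>] (0 : ℝ), ∀ δ' > 0, ∀ a : ℝ, 1 ≤ a →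
      polarIllumination P δ' ⊆ a • floatingBody P (θ ^ n) →
      1 ≤ a * (1 + δ' * illumRate P ξ) * (1 - θ * floatRate P ξ) := by
  obtain ⟨r, hr, hr1, y, hy, hcap⟩ := (hP.density_spec hn hξ).2.2
  have hα := hP.floatRate_pos hn hξ
  have hβ := hP.illumRate_pos hn hξ
  refine eventually_nhdsGT_zero (b := r / floatRate P ξ) (by positivity)
    fun θ hθ hlt δ' hδ' a ha hsub => ?_
  rw [lt_div_iff₀ hα] at hlt
  have ha0 : 0 < a := by linarith
  have hb0 : 0 < 1 + δ' * illumRate P ξ := by positivity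
  have h1 := hsub (hP.smul_mem_polarIllumination hn hδ'.le hξ)
  rw [mem_smul_set_iff_inv_smul_mem₀ ha0.ne'] at h1
  have hy0 : y ≠ 0 := by rintro rfl; simpa using hy.1
  have hpow : (θ * floatRate P ξ) ^ n * density P ξ = θ ^ n := by
    rw [mul_pow, mul_assoc, hP.floatRate_pow_mul hn hξ, mul_one]
  have h2 := h1 y (1 - θ * floatRate P ξ) hy0
    (by rw [hcap _ (by positivity) hlt.le, hpow])
  rw [inner_smul_right, inner_smul_right, real_inner_comm, hy.1, mul_one, inv_mul_le_iff₀ ha0,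
    inv_le_iff_one_le_mul₀ hb0] at h2
  linarith

theorem exists_bodyDist_admissible (hn : 1 ≤ n) (hP : IsSymmPolytope P) :
    ∃ δ₀ > 0, ∀ δ ≤ δ₀, ∀ δ' > 0, ∃ a : ℝ, 1 ≤ a ∧
      (1 / a) • floatingBody P δ ⊆ polarIllumination P δ' ∧
      polarIllumination P δ' ⊆ a • floatingBody P δ := by
  obtain ⟨δ₀, hδ₀, hhalf⟩ := hP.exists_half_smul_mem_floatingBody hn
  obtain ⟨B, hB, hBle⟩ := hP.exists_illumRate_le
  refine ⟨δ₀, hδ₀, fun δ hδ δ' hδ' => ⟨2 + δ' * B, ?_, ?_, fun x hx => ?_⟩⟩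
  · have : 0 ≤ δ' * B := by positivity
    linarith
  · rintro _ ⟨x, hx, rfl⟩
    refine hP.smul_mem_polarIllumination_of_le hn hδ'.le (by positivity) (fun ξ hξ => ?_)
      (hP.floatingBody_subset _ hx)
    have := mul_le_mul_of_nonneg_left (hBle ξ hξ) hδ'.le
    linarith
  · have ha0 : 0 < 2 + δ' * B := by positivity
    rw [mem_smul_set_iff_inv_smul_mem₀ ha0.ne']
    have hxP := hP.polarIllumination_subset hn hδ'.le hx
    have hc : 2 * (2 + δ' * B)⁻¹ ≤ 1 := by
      rw [← div_eq_mul_inv, div_le_one ha0]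
      have : 0 ≤ δ' * B := by positivity
      linarith
    have h1 := hP.convex.smul_mem_of_zero_mem hP.zero_mem hxP
      (t := 2 * (2 + δ' * B)⁻¹) ⟨by positivity, hc⟩
    have h2 := hhalf δ hδ _ h1
    rwa [smul_smul, ← mul_assoc, one_div, inv_mul_cancel₀ two_ne_zero, one_mul] at h2

theorem eventually_le_floatIllumDist (hn : 2 ≤ n) (hP : IsSymmPolytope P) {ε : ℝ} (hε : 0 < ε) :
    ∀ᶠ θ in 𝓝[>] (0 : ℝ), 1 + θ * (G P - ε) ≤ floatIllumDist P (θ ^ n) := by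
  have hn1 : 1 ≤ n := by omega
  have hG := hP.G_nonneg hn1
  set K := G P with hK
  obtain ⟨δ₀, hδ₀, hadm⟩ := hP.exists_bodyDist_admissible hn1
  have hev1 : ∀ᶠ θ in 𝓝[>] (0 : ℝ), θ ^ n < δ₀ ∧ θ * (K * (K + ε)) < ε := by
    have h1 : Tendsto (fun θ : ℝ => θ ^ n) (𝓝[>] 0) (𝓝 0) :=
      ((continuous_pow n).tendsto' 0 0 (zero_pow (by omega))).mono_left nhdsWithin_le_nhds
    have h2 : Tendsto (fun θ : ℝ => θ * (K * (K + ε))) (𝓝[>] 0) (𝓝 0) :=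
      ((by fun_prop : Continuous fun θ : ℝ => θ * (K * (K + ε))).tendsto' 0 0
        (by simp)).mono_left nhdsWithin_le_nhds
    exact (h1.eventually (gt_mem_nhds hδ₀)).and (h2.eventually (gt_mem_nhds hε))
  have hev2 := (Filter.eventually_all_finite hP.finite_extremePoints).2 fun ξ hξ =>
    hP.eventually_mul_illumRate_le hn hξ hG hε
  have hev3 := (Filter.eventually_all_finite hP.finite_extremePoints).2 fun ξ hξ =>
    hP.eventually_one_le_of_polarIllumination_subset hn1 hξ
  filter_upwards [hev1, hev2, hev3, self_mem_nhdsWithin] with θ ⟨hθ1, hθ2⟩ h2 h3 hθ0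
  rw [mem_Ioi] at hθ0
  refine le_ciInf fun δ' => le_bodyDist (hadm _ hθ1.le δ' δ'.2) fun a ha hsub1 hsub2 => ?_
  obtain ⟨δ', hδ'⟩ := δ'
  -- Only `a` close to one needs work. Then `δ'` is of order `θ` as well, so products of the two
  -- errors are of second order.
  rcases le_or_gt a (1 + θ * K) with haK | haK
  swap
  · have := mul_pos hθ0 hε
    linarith
  have hle : Gc P (δ' / θ) ≤ (a - 1) / θ + ε := by
    refine (hP.Gc_le_iff hn1 (div_pos hδ' hθ0).le).2 fun ξ hξ => ?_
    have hα := hP.floatRate_pos hn1 hξ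
    have hβ := hP.illumRate_pos hn1 hξ
    have h4 := h2 ξ hξ δ' hδ' a ha haK hsub1
    have h5 := h3 ξ hξ δ' hδ' a ha hsub2
    have hdiv : δ' / θ * illumRate P ξ = δ' * illumRate P ξ / θ := by ring
    have hrhs : (a - 1) / θ + ε = (a - 1 + ε * θ) / θ := by field_simp
    rw [hdiv, hrhs]
    refine ⟨?_, div_le_div_of_nonneg_right h4 hθ0.le⟩
    rw [sub_le_iff_le_add, ← add_div, le_div_iff₀ hθ0]
    set b := δ' * illumRate P ξ with hb
    have hb0 : 0 < b := mul_pos hδ' hβ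
    have h6 : (a - 1) * b ≤ ε * θ := by
      have h7 : (a - 1) * b ≤ (θ * K) * (θ * (K + ε)) :=
        mul_le_mul (by linarith) (by linarith) hb0.le (by positivity)
      nlinarith
    have h8 : 0 ≤ (a * (1 + b) - 1) * (θ * floatRate P ξ) := by
      have : 1 ≤ a * (1 + b) := by nlinarith
      exact mul_nonneg (by linarith) (by positivity)
    linarith
  have hGle : G P ≤ Gc P (δ' / θ) :=
    (hP.isLeast_G hn1).2 ⟨δ' / θ, (div_pos hδ' hθ0).le, rfl⟩
  have h9 : K - ε ≤ (a - 1) / θ := by linarith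
  rw [le_div_iff₀ hθ0] at h9
  linarith

/-! ### The limit. -/

theorem tendsto_floatIllumDist (hn : 2 ≤ n) (hP : IsSymmPolytope P) :
    Tendsto (fun δ : ℝ => (floatIllumDist P δ - 1) / δ ^ (1 / n : ℝ)) (𝓝[>] 0) (𝓝 (G P)) := by
  have hn0 : n ≠ 0 := by omega
  have hnpos : (0 : ℝ) < 1 / n := by
    have : (0 : ℝ) < n := by exact_mod_cast Nat.pos_of_ne_zero hn0
    positivity
  have hroot : Tendsto (fun δ : ℝ => δ ^ (1 / n : ℝ)) (𝓝[>] 0) (𝓝[>] 0) := by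
    refine tendsto_nhdsWithin_iff.2 ⟨?_, ?_⟩
    · exact ((Real.continuousAt_rpow_const 0 _ (Or.inr hnpos.le)).tendsto.mono_left
        nhdsWithin_le_nhds).trans (by rw [Real.zero_rpow hnpos.ne'])
    · filter_upwards [self_mem_nhdsWithin] with δ hδ
      exact Real.rpow_pos_of_pos hδ _
  have hmain : Tendsto (fun θ : ℝ => (floatIllumDist P (θ ^ n) - 1) / θ) (𝓝[>] 0) (𝓝 (G P)) := by
    refine Metric.tendsto_nhds.2 fun ε hε => ?_
    filter_upwards [hP.eventually_floatIllumDist_le (by omega) (half_pos hε),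
      hP.eventually_le_floatIllumDist hn (half_pos hε), self_mem_nhdsWithin] with θ h1 h2 hθ0
    rw [mem_Ioi] at hθ0
    have h3 : (floatIllumDist P (θ ^ n) - 1) / θ ≤ G P + ε / 2 := by
      rw [div_le_iff₀ hθ0]; linarith
    have h4 : G P - ε / 2 ≤ (floatIllumDist P (θ ^ n) - 1) / θ := by
      rw [le_div_iff₀ hθ0]; linarith
    rw [Real.dist_eq, abs_lt]
    constructor <;> linarith
  refine (hmain.comp hroot).congr' ?_
  filter_upwards [self_mem_nhdsWithin] with δ hδ
  rw [mem_Ioi] at hδ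
  simp only [Function.comp_apply]
  rw [one_div, Real.rpow_inv_natCast_pow hδ.le hn0]

theorem image (hP : IsSymmPolytope P) (L : E n ≃ₗ[ℝ] E n) : IsSymmPolytope (L '' P) where
  exists_finite := by
    obtain ⟨V, hV, rfl⟩ := hP.exists_finite
    exact ⟨L '' V, hV.image _, L.toLinearMap.image_convexHull V⟩
  interior_nonempty := by
    have h := L.toContinuousLinearEquiv.toHomeomorph.image_interior P
    exact h ▸ hP.interior_nonempty.image _
  symm := by
    rintro _ ⟨x, hx, rfl⟩
    exact ⟨-x, hP.symm x hx, map_neg L x⟩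

end IsSymmPolytope

/-! ### Linear invariance -/

/-- The inverse adjoint, by which normals and polars transform. -/
theorem exists_contragredient (L : E n ≃ₗ[ℝ] E n) :
    ∃ A : E n ≃ₗ[ℝ] E n, ∀ x y, ⟪L x, A y⟫ = ⟪x, y⟫ := by
  refine ⟨LinearEquiv.ofLinearMap (LinearMap.adjoint L.symm.toLinearMap)
    (LinearMap.adjoint L.toLinearMap) ?_ ?_, fun x y => ?_⟩
  · rw [← LinearMap.adjoint_comp, LinearEquiv.comp_symm, LinearMap.adjoint_id]
  · rw [← LinearMap.adjoint_comp, LinearEquiv.symm_comp, LinearMap.adjoint_id]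
  · rw [LinearEquiv.coe_ofLinearMap, LinearMap.adjoint_inner_right]
    simp

theorem volume_image_le_iff (L : E n ≃ₗ[ℝ] E n) (A B : Set (E n)) (c : ENNReal) :
    volume (L '' A) ≤ c * volume (L '' B) ↔ volume A ≤ c * volume B := by
  have hdet : ENNReal.ofReal |LinearMap.det L.toLinearMap| ≠ 0 :=
    (ENNReal.ofReal_pos.2 (abs_pos.2 L.isUnit_det'.ne_zero)).ne'
  have h := Measure.addHaar_image_linearMap (volume : Measure (E n)) L.toLinearMap
  simp only [LinearEquiv.coe_coe] at h
  rw [h, h, mul_left_comm, ENNReal.mul_le_mul_iff_right hdet ENNReal.ofReal_ne_top]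

theorem polar_image {L A : E n ≃ₗ[ℝ] E n} (h : ∀ x y, ⟪L x, A y⟫ = ⟪x, y⟫) (K : Set (E n)) :
    polar (L '' K) = A '' polar K := by
  ext y
  obtain ⟨y, rfl⟩ := A.surjective y
  rw [A.injective.mem_set_image]
  simp only [polar, mem_ofPred_eq, forall_mem_image, h]

theorem illuminationBody_image (L : E n ≃ₗ[ℝ] E n) (K : Set (E n)) (δ : ℝ) :
    illuminationBody (L '' K) δ = L '' illuminationBody K δ := by
  ext x
  obtain ⟨x, rfl⟩ := L.surjective x
  have h : convexHull ℝ (L '' K ∪ {L x}) = L '' convexHull ℝ (K ∪ {x}) := by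
    rw [← image_singleton, ← image_union]
    exact (L.toLinearMap.image_convexHull _).symm
  rw [L.injective.mem_set_image, illuminationBody, illuminationBody, mem_ofPred_eq, mem_ofPred_eq,
    h, volume_image_le_iff]

theorem polarIllumination_image (L : E n ≃ₗ[ℝ] E n) (K : Set (E n)) (δ : ℝ) :
    polarIllumination (L '' K) δ = L '' polarIllumination K δ := by
  obtain ⟨A, hA⟩ := exists_contragredient L
  have hA' : ∀ x y, ⟪A x, L y⟫ = ⟪x, y⟫ := fun x y => by
    rw [real_inner_comm, hA, real_inner_comm]
  rw [polarIllumination, polarIllumination, polar_image hA, illuminationBody_image,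
    polar_image hA']

theorem floatingBody_image (L : E n ≃ₗ[ℝ] E n) (K : Set (E n)) (δ : ℝ) :
    floatingBody (L '' K) δ = L '' floatingBody K δ := by
  obtain ⟨A, hA⟩ := exists_contragredient L
  have hA' : ∀ x y, ⟪A x, L y⟫ = ⟪x, y⟫ := fun x y => by
    rw [real_inner_comm, hA, real_inner_comm]
  ext x
  obtain ⟨x, rfl⟩ := L.surjective x
  rw [L.injective.mem_set_image, floatingBody, floatingBody, mem_ofPred_eq, mem_ofPred_eq,
    A.surjective.forall]
  refine forall₂_congr fun u t => ?_
  have hcap : L '' K ∩ {y | t ≤ ⟪A u, y⟫} = L '' (K ∩ {y | t ≤ ⟪u, y⟫}) := by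
    ext y
    obtain ⟨y, rfl⟩ := L.surjective y
    simp only [mem_inter_iff, L.injective.mem_set_image, mem_ofPred_eq, hA']
  rw [hcap, volume_image_le_iff, hA', Ne, Ne, LinearEquiv.map_eq_zero_iff]

theorem bodyDist_image (L : E n ≃ₗ[ℝ] E n) (S₁ S₂ : Set (E n)) :
    bodyDist (L '' S₁) (L '' S₂) = bodyDist S₁ S₂ := by
  have hsmul : ∀ (a : ℝ) (S : Set (E n)), a • L '' S = L '' (a • S) := fun a S =>
    (image_smul_set L a S).symm
  simp only [bodyDist, hsmul, image_subset_image_iff L.injective]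

theorem floatIllumDist_image (L : E n ≃ₗ[ℝ] E n) (K : Set (E n)) (δ : ℝ) :
    floatIllumDist (L '' K) δ = floatIllumDist K δ := by
  simp only [floatIllumDist, floatingBody_image, polarIllumination_image, bodyDist_image]

/-- The distance is linearly invariant, so uniqueness of limits gives the claim without tracking
Santaló points or facet areas under `L`. -/
theorem IsSymmPolytope.G_image (hn : 2 ≤ n) (hP : IsSymmPolytope P) (L : E n ≃ₗ[ℝ] E n) :
    G (L '' P) = G P := by
  have h := (hP.image L).tendsto_floatIllumDist hn
  simp only [floatIllumDist_image] at h
  exact tendsto_nhds_unique h (hP.tendsto_floatIllumDist hn)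

end FloatIllum

end

theorem mainTheorem1 (n : ℕ) (hn : 2 ≤ n) (P : Set (FloatIllum.E n))
    (hP : FloatIllum.IsSymmPolytope P) :
    IsLeast (FloatIllum.Gc P '' Set.Ici 0) (FloatIllum.G P) ∧
    Filter.Tendsto (fun δ : ℝ => (FloatIllum.floatIllumDist P δ - 1) / δ ^ (1 / n : ℝ))
      (𝓝[>] 0) (𝓝 (FloatIllum.G P)) ∧
    ∀ L : FloatIllum.E n ≃ₗ[ℝ] FloatIllum.E n, FloatIllum.G (L '' P) = FloatIllum.G P := by
  exact ⟨hP.isLeast_G (by omega), hP.tendsto_floatIllumDist hn, fun L => hP.G_image hn L⟩
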